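/- **Conventions.** A differential structure $\mathcal C$ on a set $M$ is a non-empty family of functions $M\to\mathbb R$ that is closed under superposition with $C^\infty$ functions on $\mathbb R^n$ and under localization, with respect to the weakest topology making its members continuous. $\mathcal G$ generates $\mathcal C$ if $\mathcal C$ consists of the functions which are locally of the form $\sigma(g_1,\dots,g_m)$ with $\sigma\in C^\infty(\mathbb R^m)$, $g_i\in\mathcal G$. $T_pM$ is the space of derivations of $\mathcal C$ at $p$, $TM$ is the disjoint union of the $T_pM$, $\pi:TM\to M$ is the projection, and $d\alpha(v)=v(\alpha)$. A point $k$-form is a skew-symmetric $k$-linear form on each $T_pM$; it is smooth if, as a function on $T^kM=\{(v_1,\dots,v_k):\pi(v_1)=\dots=\pi(v_k)\}$, it belongs to the differential structure generated by the functions $\alpha\circ\pi$ and $(v_1,\dots,v_k)\mapsto d\alpha(v_i)$, $\alpha\in\mathcal C$ (smooth functions, if $k=0$). Pullbacks are taken along the tangent maps $(TF\,v)(f)=v(f\circ F)$. A generalized smooth $n$-cube on $M$ is a smooth map $\varphi:(D,C^\infty(\mathbb R^n)_D)\to(M,\mathcal C)$ with $D$ dense in $[0,1]^n$; a smooth $n$-chain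 is a finite formal combination $\Phi=\sum c_j\varphi_j$ of such cubes. For an $n$-form $\omega$, write $\varphi^*\omega=\omega_0\,dt^1\wedge\dots\wedge dt^n$ on $D$; if $\omega_0$ has a continuous extension $\tilde\omega_0$ to $[0,1]^n$, the integral exists and $\int_\varphi\omega=\int_{[0,1]^n}\tilde\omega_0$. The integral of a $k$-form on an $n$-cube with $k\ne n$ is $0$. Finally $\int_\Phi\omega=\sum c_j\int_{\varphi_j}\omega$. A family $\mathcal H$ of real functions on a set $X$ defines the weakest uniform structure on $X$ for which its members are uniformly continuous; $\mathrm{compl}_{\mathcal H}X$ is the (Hausdorff) completion, with the differential structure generated by the continuous extensions of the members of $\mathcal H$. Let $\iota:M\to\mathrm{compl}_{\mathcal G}M$ be the natural map, and $\mathcal T\mathcal G_0=\{g\circ\pi,\ dg: g\in\mathcal G\}$. A cube $\varphi:D\to M$ is smoothly extendable with respect to $\mathcal G$ if $T\varphi:TD=D\times\mathbb R^n\to TM$ is uniformly continuous, for the uniform structure defined on $TM$ by $\mathcal T\mathcal G_0$, on $\{(t,a)\in D\times\mathbb R^n:\|a\|\le R\}$ for every $R$, and its continuous extension $[0,1]^n\times\mathbb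 R^n\to\mathrm{compl}_{\mathcal T\mathcal G_0}TM$ is smooth. Then $\varphi$ has a continuous extension $\tilde\varphi:[0,1]^n\to\mathrm{compl}_{\mathcal G}M$, which is smooth, and $$\partial_{\mathcal G}\varphi=\sum_{i=1}^n\sum_{\alpha=0,1}(-1)^{i+\alpha}\,\tilde\varphi\circ I_{(i,\alpha)},$$ a chain on $\mathrm{compl}_{\mathcal G}M$, where $I_{(i,\alpha)}:[0,1]^{n-1}\to[0,1]^n$ inserts $\alpha$ at the $i$-th place. A chain is smoothly extendable if every cube of its support is, and $\partial_{\mathcal G}\sum c_j\varphi_j=\sum c_j\,\partial_{\mathcal G}\varphi_j$. A smooth point $k$-form $\eta$ on $M$ is smoothly extendable if $\eta=\iota^*\eta'$ for some smooth point $k$-form $\eta'$ on $\mathrm{compl}_{\mathcal G}M$. **Theorem (analogue of Stokes' theorem).** Let $\mathcal C$ be a differential structure on $M$, generated by a family $\mathcal G$ of functions with $|g|\le1$ for all $g\in\mathcal G$. Equip $[-1,1]^{\mathcal G}$ with the differential structure generated by the coordinate functions, and let $e:M\to[-1,1]^{\mathcal G}$, $e(x)=(g(x))_{g\in\mathcal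 G}$. Let $k\ge0$, $n\ge1$, let $\eta$ be a smooth point $k$-form on $M$ and $\Phi$ a smooth generalized $n$-chain on $M$, both smoothly extendable with respect to $\mathcal G$. Let $\tilde\eta$ be any smooth extension of $\eta$ to $[-1,1]^{\mathcal G}$, that is, any smooth point $k$-form there with $e^*\tilde\eta=\eta$, and let $d\tilde\eta$ be its exterior derivative, $$(d\tilde\eta)(v_1,\dots,v_{k+1})=\sum_{i=1}^{k+1}(-1)^{i+1}v_i\big(\tilde\eta(X_1,\dots,\widehat{X_i},\dots,X_{k+1})\big),$$ where $X_j$ is the constant vector field on $[-1,1]^{\mathcal G}$ with value $v_j$ at the given point. Then the integrals below exist and $$\int_{\partial_{\mathcal G}\Phi}\eta=\int_\Phi d\tilde\eta .$$ Here the right-hand side is $\int_\Phi e^*(d\tilde\eta)$, and the left-hand side is $\int_{\partial_{\mathcal G}\Phi}\eta'$, for every smooth point $k$-form $\eta'$ on $\mathrm{compl}_{\mathcal G}M$ with $\iota^*\eta'=\eta$. -/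

import Mathlib

open Set Topology
open scoped ContDiff

namespace DiffSpace

universe u v w

/-! ### Differential structures -/

/-- The weakest topology for which all functions of the family `G` are continuous. -/
abbrev initialTopology {M : Type u} (G : Set (M → ℝ)) : TopologicalSpace M :=
  ⨅ g ∈ G, TopologicalSpace.induced g inferInstance

/-- A differential structure (in the sense of Sikorski) on a set `M`: a family of real functions
which is closed under superposition with smooth functions on `ℝⁿ` and under localization (a
function that agrees near every point with a member of the family is a member).  The topology is
the weakest one that makes all members continuous.  (The case `n = 0` of `comp_mem` says that
constants belong to the family, so that the family is not empty.) -/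
structure DiffStructure (M : Type u) where
  carrier : Set (M → ℝ)
  comp_mem : ∀ (n : ℕ) (σ : (Fin n → ℝ) → ℝ), ContDiff ℝ ∞ σ →
    ∀ f : Fin n → M → ℝ, (∀ i, f i ∈ carrier) → (fun x => σ fun i => f i x) ∈ carrier
  local_mem : ∀ f : M → ℝ,
    (∀ x, ∃ U : Set M, IsOpen[initialTopology carrier] U ∧ x ∈ U ∧
      ∃ g ∈ carrier, ∀ y ∈ U, f y = g y) → f ∈ carrier

theorem continuous_of_mem {M : Type u} {G : Set (M → ℝ)} {g : M → ℝ} (hg : g ∈ G) :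
    @Continuous M ℝ (initialTopology G) _ g := by
  rw [continuous_iff_le_induced]
  exact iInf₂_le g hg

theorem le_initialTopology {M : Type u} {G : Set (M → ℝ)} {t : TopologicalSpace M}
    (h : ∀ g ∈ G, @Continuous M ℝ t _ g) : t ≤ initialTopology G :=
  le_iInf₂ fun g hg => continuous_iff_le_induced.1 (h g hg)

theorem continuous_rng {X : Type v} {M : Type u} {G : Set (M → ℝ)} {t : TopologicalSpace X}
    {F : X → M} (h : ∀ g ∈ G, @Continuous X ℝ t _ (g ∘ F)) :
    @Continuous X M t (initialTopology G) F := by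
  refine continuous_iff_le_induced.2 ?_
  rw [initialTopology, induced_iInf]
  refine le_iInf fun g => ?_
  rw [induced_iInf]
  refine le_iInf fun hg => ?_
  rw [induced_compose]
  exact continuous_iff_le_induced.1 (h g hg)

/-- Functions that are locally of the form `σ(g₁, …, gₙ)` with `σ` smooth and `gᵢ ∈ G`. -/
def generateCarrier {M : Type u} (G : Set (M → ℝ)) : Set (M → ℝ) :=
  {f | ∀ x, ∃ U : Set M, IsOpen[initialTopology G] U ∧ x ∈ U ∧
    ∃ (n : ℕ) (g : Fin n → M → ℝ), (∀ i, g i ∈ G) ∧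
      ∃ σ : (Fin n → ℝ) → ℝ, ContDiff ℝ ∞ σ ∧ ∀ y ∈ U, f y = σ fun i => g i y}

theorem continuous_of_mem_generateCarrier {M : Type u} {G : Set (M → ℝ)} {f : M → ℝ}
    (hf : f ∈ generateCarrier G) : @Continuous M ℝ (initialTopology G) _ f := by
  let _ := initialTopology G
  rw [continuous_iff_continuousAt]
  intro x
  obtain ⟨U, hU, hx, n, g, hg, σ, hσ, hf⟩ := hf x
  have h1 : Continuous fun y => σ fun i => g i y :=
    hσ.continuous.comp (continuous_pi fun i => continuous_of_mem (hg i))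
  refine h1.continuousAt.congr ?_
  filter_upwards [IsOpen.mem_nhds hU hx] with y hy
  exact (hf y hy).symm

/-- The differential structure generated by a family of functions. -/
def generate {M : Type u} (G : Set (M → ℝ)) : DiffStructure M where
  carrier := generateCarrier G
  comp_mem := by
    intro n σ hσ f hf x
    choose U hU hx m g hg τ hτ hfτ using fun i => hf i x
    refine ⟨⋂ i, U i, @isOpen_iInter_of_finite M _ (initialTopology G) _ _ hU,
      mem_iInter.2 hx, ∑ i, m i,
      fun k => g (finSigmaFinEquiv.symm k).1 (finSigmaFinEquiv.symm k).2, fun k => hg _ _,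
      fun z => σ fun i => τ i fun j => z (finSigmaFinEquiv ⟨i, j⟩), ?_, ?_⟩
    · refine hσ.comp (contDiff_pi.2 fun i => (hτ i).comp (contDiff_pi.2 fun j => ?_))
      exact contDiff_apply ℝ ℝ _
    · intro y hy
      have h2 : ∀ i, f i y = τ i fun j => g i j y := fun i => hfτ i y (mem_iInter.1 hy i)
      let K : (Σ i, Fin (m i)) → ℝ := fun p => g p.1 p.2 y
      change σ (fun i => f i y) =
        σ fun i => τ i fun j => K (finSigmaFinEquiv.symm (finSigmaFinEquiv ⟨i, j⟩))
      simp only [h2, Equiv.symm_apply_apply]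
      rfl
  local_mem := by
    intro f hf x
    obtain ⟨U, hU, hx, g, hg, hfg⟩ := hf x
    obtain ⟨V, hV, hxV, n, k, hk, σ, hσ, hgσ⟩ := hg x
    have hle : initialTopology G ≤ initialTopology (generateCarrier G) :=
      le_initialTopology fun g hg => continuous_of_mem_generateCarrier hg
    exact ⟨U ∩ V, @IsOpen.inter M (initialTopology G) U V (hle U hU) hV, ⟨hx, hxV⟩, n, k, hk, σ,
      hσ, fun y hy => (hfg y hy.1).trans (hgσ y hy.2)⟩

theorem subset_generate {M : Type u} (G : Set (M → ℝ)) : G ⊆ (generate G).carrier := by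
  intro g hg x
  refine ⟨univ, @isOpen_univ M (initialTopology G), mem_univ x, 1, fun _ => g, fun _ => hg,
    fun z => z 0, contDiff_apply ℝ ℝ 0, fun y _ => rfl⟩

theorem generate_subset {M : Type u} {G : Set (M → ℝ)} {C : DiffStructure M}
    (h : G ⊆ C.carrier) : (generate G).carrier ⊆ C.carrier := by
  intro f hf
  refine C.local_mem f fun x => ?_
  obtain ⟨U, hU, hx, n, g, hg, σ, hσ, hfσ⟩ := hf x
  have hle : initialTopology C.carrier ≤ initialTopology G :=
    le_initialTopology fun g hg => continuous_of_mem (h hg)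
  exact ⟨U, hle U hU, hx, _, C.comp_mem n σ hσ g fun i => h (hg i), hfσ⟩

/-- `F : (M, C) → (N, D)` is smooth. -/
def SmoothMap {M : Type u} {N : Type v} (C : DiffStructure M) (D : DiffStructure N)
    (F : M → N) : Prop :=
  ∀ f ∈ D.carrier, f ∘ F ∈ C.carrier

theorem SmoothMap.continuous {M : Type u} {N : Type v} {C : DiffStructure M}
    {D : DiffStructure N} {F : M → N} (hF : SmoothMap C D F) :
    @Continuous M N (initialTopology C.carrier) (initialTopology D.carrier) F :=
  @continuous_rng M N D.carrier (initialTopology C.carrier) F fun f hf => continuous_of_mem (hF f hf)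

/-- Smoothness may be tested on generators. -/
theorem smoothMap_generate {M : Type u} {N : Type v} {C : DiffStructure M}
    {G : Set (N → ℝ)} {F : M → N} (hF : ∀ g ∈ G, g ∘ F ∈ C.carrier) :
    SmoothMap C (generate G) F := by
  intro f hf
  refine C.local_mem _ fun x => ?_
  obtain ⟨U, hU, hx, n, g, hg, σ, hσ, hfσ⟩ := hf (F x)
  have hc : @Continuous M N (initialTopology C.carrier) (initialTopology G) F :=
    continuous_rng fun g hg => continuous_of_mem (hF g hg)
  refine ⟨F ⁻¹' U, ?_, hx, _, C.comp_mem n σ hσ (fun i => g i ∘ F) fun i => hF _ (hg i), ?_⟩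
  · exact @Continuous.isOpen_preimage M N (initialTopology C.carrier) (initialTopology G) F hc U hU
  · exact fun y hy => hfσ (F y) hy

/-- `C^∞(E)_D`: functions on a subset `D` of `E` that are locally restrictions of smooth
functions on `E`. -/
def smoothOn {E : Type v} [NormedAddCommGroup E] [NormedSpace ℝ E] (D : Set E) :
    DiffStructure D where
  carrier := {f | ∀ x : D, ∃ U ∈ 𝓝 (x : E), ∃ F : E → ℝ, ContDiff ℝ ∞ F ∧
    ∀ y : D, (y : E) ∈ U → f y = F y}
  comp_mem := by
    intro n σ hσ f hf x
    choose U hU F hF hfF using fun i => hf i x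
    refine ⟨⋂ i, U i, Filter.iInter_mem.2 hU, fun z => σ fun i => F i z,
      hσ.comp (contDiff_pi.2 hF), fun y hy => ?_⟩
    have h2 : ∀ i, f i y = F i y := fun i => hfF i y (mem_iInter.1 hy i)
    simp [h2]
  local_mem := by
    intro f hf x
    obtain ⟨V, hV, hx, g, hg, hfg⟩ := hf x
    obtain ⟨U, hU, F, hF, hgF⟩ := hg x
    have hle : (inferInstance : TopologicalSpace D) ≤
        initialTopology {f : D → ℝ | ∀ x : D, ∃ U ∈ 𝓝 (x : E), ∃ F : E → ℝ, ContDiff ℝ ∞ F ∧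
          ∀ y : D, (y : E) ∈ U → f y = F y} := by
      refine le_initialTopology fun k hk => continuous_iff_continuousAt.2 fun z => ?_
      obtain ⟨W, hW, K, hK, hkK⟩ := hk z
      refine (hK.continuous.comp continuous_subtype_val).continuousAt.congr ?_
      filter_upwards [continuous_subtype_val.continuousAt hW] with y hy
      exact (hkK y hy).symm
    have hV' : V ∈ 𝓝 x := IsOpen.mem_nhds (hle V hV) hx
    obtain ⟨V', hV', hVV⟩ := mem_nhds_subtype D x V |>.1 hV'
    exact ⟨U ∩ V', Filter.inter_mem hU hV', F, hF, fun y hy =>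
      (hfg y (hVV hy.2)).trans (hgF y hy.1)⟩

/-- The algebra of smooth functions. -/
def DiffStructure.algebra {M : Type u} (C : DiffStructure M) : Subalgebra ℝ (M → ℝ) where
  carrier := C.carrier
  mul_mem' := by
    intro f g hf hg
    have := C.comp_mem 2 (fun z => z 0 * z 1)
      ((contDiff_apply ℝ ℝ (0 : Fin 2)).mul (contDiff_apply ℝ ℝ (1 : Fin 2)))
      ![f, g] (by intro i; fin_cases i <;> assumption)
    exact this
  add_mem' := by
    intro f g hf hg
    have := C.comp_mem 2 (fun z => z 0 + z 1)
      ((contDiff_apply ℝ ℝ (0 : Fin 2)).add (contDiff_apply ℝ ℝ (1 : Fin 2)))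
      ![f, g] (by intro i; fin_cases i <;> assumption)
    exact this
  algebraMap_mem' := by
    intro r
    exact C.comp_mem 0 (fun _ => r) contDiff_const (fun _ _ => 0) (fun i => i.elim0)

/-! ### Tangent spaces and tangent maps -/

/-- The tangent space at `m`: derivations at `m` of the algebra of smooth functions. -/
def DiffStructure.Tangent {M : Type u} (C : DiffStructure M) (m : M) :
    Submodule ℝ (Module.Dual ℝ C.algebra) where
  carrier := {v | ∀ f g : C.algebra, v (f * g) = f.1 m * v g + g.1 m * v f}
  zero_mem' := by intro f g; simp
  add_mem' := by
    intro v w hv hw f g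
    simp only [LinearMap.add_apply, hv f g, hw f g]
    ring
  smul_mem' := by
    intro c v hv f g
    simp only [LinearMap.smul_apply, hv f g, smul_eq_mul]
    ring

/-- The tangent bundle `TM`. -/
abbrev DiffStructure.TangentBundle {M : Type u} (C : DiffStructure M) : Type u :=
  Σ m : M, C.Tangent m

/-- `dα : TM → ℝ`, `dα(v) = v(α)`. -/
def DiffStructure.diff {M : Type u} (C : DiffStructure M) (α : C.algebra) :
    C.TangentBundle → ℝ :=
  fun v => v.2.1 α

/-- Composition with a smooth map, as a linear map between the algebras of smooth functions. -/
def SmoothMap.comap {M : Type u} {N : Type v} {C : DiffStructure M} {D : DiffStructure N}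
    {F : M → N} (hF : SmoothMap C D F) : D.algebra →ₗ[ℝ] C.algebra where
  toFun f := ⟨f.1 ∘ F, hF f.1 f.2⟩
  map_add' _ _ := rfl
  map_smul' _ _ := rfl

/-- The tangent map `(TF v)(f) = v(f ∘ F)`. -/
def SmoothMap.tangentMap {M : Type u} {N : Type v} {C : DiffStructure M} {D : DiffStructure N}
    {F : M → N} (hF : SmoothMap C D F) (m : M) : C.Tangent m →ₗ[ℝ] D.Tangent (F m) where
  toFun v := ⟨v.1 ∘ₗ hF.comap, fun f g => v.2 (hF.comap f) (hF.comap g)⟩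
  map_add' _ _ := rfl
  map_smul' _ _ := rfl

/-! ### Point forms -/

/-- Skew-symmetric point `k`-forms. -/
def PointForm {M : Type u} (C : DiffStructure M) (k : ℕ) : Type u :=
  ∀ m : M, (C.Tangent m) [⋀^Fin k]→ₗ[ℝ] ℝ

/-- The set `T^k M` of `k`-tuples of tangent vectors with a common base point. -/
abbrev DiffStructure.TangentPower {M : Type u} (C : DiffStructure M) (k : ℕ) : Type u :=
  Σ m : M, Fin k → C.Tangent m

/-- The differential structure of `T^k M`, generated by the functions `α` of the base point and
`dα` of the single vectors.  For `k = 0` this is the space `(M, C)` itself. -/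
def DiffStructure.tangentPowerStructure {M : Type u} (C : DiffStructure M) (k : ℕ) :
    DiffStructure (C.TangentPower k) :=
  generate ({h | ∃ α ∈ C.carrier, h = fun p => α p.1} ∪
    {h | ∃ (α : C.algebra) (i : Fin k), h = fun p => C.diff α ⟨p.1, p.2 i⟩})

/-- Smoothness of a point `k`-form, as a function on `T^k M`. -/
def PointForm.IsSmooth {M : Type u} {C : DiffStructure M} {k : ℕ} (η : PointForm C k) : Prop :=
  (fun p : C.TangentPower k => η p.1 p.2) ∈ (C.tangentPowerStructure k).carrier

/-- The pullback `F^* η`. -/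
def PointForm.pullback {M : Type u} {N : Type v} {C : DiffStructure M} {D : DiffStructure N}
    {F : M → N} {k : ℕ} (η : PointForm D k) (hF : SmoothMap C D F) : PointForm C k :=
  fun m => (η (F m)).compLinearMap (hF.tangentMap m)

/-! ### Generalized cubes and chains, integrals -/

/-- The standard `n`-dimensional interval `[0,1]^n`. -/
abbrev unitCube (n : ℕ) : Set (Fin n → ℝ) := Icc 0 1

/-- Generalized `n`-dimensional smooth cubes on `(M, C)`: smooth maps from a dense subset of
`[0,1]^n` to `M`. -/
structure GenCube {M : Type u} (C : DiffStructure M) (n : ℕ) where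
  dom : Set (Fin n → ℝ)
  dom_subset : dom ⊆ unitCube n
  dense : unitCube n ⊆ closure dom
  toFun : dom → M
  smooth : SmoothMap (smoothOn dom) C toFun

theorem uniqueDiffOn_unitCube (n : ℕ) : UniqueDiffOn ℝ (unitCube n) := by
  rw [unitCube, ← pi_univ_Icc]
  exact UniqueDiffOn.univ_pi fun i => uniqueDiffOn_Icc (by simp)

theorem GenCube.uniqueDiffWithinAt {M : Type u} {C : DiffStructure M} {n : ℕ} (φ : GenCube C n)
    (t : φ.dom) : UniqueDiffWithinAt ℝ φ.dom (t : Fin n → ℝ) :=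
  (uniqueDiffOn_unitCube n t (φ.dom_subset t.2)).mono_closure φ.dense

theorem differentiableWithinAt_extend {E : Type v} [NormedAddCommGroup E] [NormedSpace ℝ E]
    {D : Set E} {f : D → ℝ} (hf : f ∈ (smoothOn D).carrier) (t : D) :
    DifferentiableWithinAt ℝ (Function.extend Subtype.val f 0) D (t : E) := by
  obtain ⟨U, hU, F, hF, hfF⟩ := hf t
  refine ((hF.differentiable (by simp)) (t : E)).differentiableWithinAt.congr_of_eventuallyEq
    ?_ ?_
  · filter_upwards [self_mem_nhdsWithin, mem_nhdsWithin_of_mem_nhds hU] with y hy hyU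
    rw [← hfF ⟨y, hy⟩ hyU]
    exact Subtype.val_injective.extend_apply f 0 ⟨y, hy⟩
  · rw [← hfF t (mem_of_mem_nhds hU)]
    exact Subtype.val_injective.extend_apply f 0 t

/-- The vector `∑ aⁱ ∂/∂tⁱ` tangent at `t` to `(D, C^∞(E)_D)`, for a set `D` at whose point `t`
derivatives along `D` are unique: it sends `f` to the derivative at `t`, in the direction `a`, of
any local smooth extension of `f`. -/
noncomputable def tangentVector {E : Type v} [NormedAddCommGroup E] [NormedSpace ℝ E]
    {D : Set E} (t : D) (hD : UniqueDiffWithinAt ℝ D (t : E)) (a : E) :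
    (smoothOn D).Tangent t where
  val :=
    { toFun := fun f => fderivWithin ℝ (Function.extend Subtype.val f.1 0) D (t : E) a
      map_add' := by
        intro f g
        have h : Function.extend Subtype.val (f + g).1 (0 : E → ℝ) =
            Function.extend Subtype.val f.1 0 + Function.extend Subtype.val g.1 0 := by
          rw [← Function.extend_add]
          simp
        rw [h, fderivWithin_add hD (differentiableWithinAt_extend f.2 t)
          (differentiableWithinAt_extend g.2 t)]
        rfl
      map_smul' := by
        intro c f
        have h : Function.extend Subtype.val (c • f).1 (0 : E → ℝ) =
            c • Function.extend Subtype.val f.1 0 := by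
          rw [← Function.extend_smul]
          simp
        rw [h, fderivWithin_const_smul hD (differentiableWithinAt_extend f.2 t)]
        rfl }
  property := by
    intro f g
    have h : Function.extend Subtype.val (f * g).1 (0 : E → ℝ) =
        Function.extend Subtype.val f.1 0 * Function.extend Subtype.val g.1 0 := by
      rw [← Function.extend_mul]
      simp
    have h1 : ∀ k : D → ℝ, Function.extend Subtype.val k (0 : E → ℝ) (t : E) = k t := fun k =>
      Subtype.val_injective.extend_apply k 0 t
    change fderivWithin ℝ (Function.extend Subtype.val (f * g).1 0) D (t : E) a =
      f.1 t * fderivWithin ℝ (Function.extend Subtype.val g.1 0) D (t : E) a +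
      g.1 t * fderivWithin ℝ (Function.extend Subtype.val f.1 0) D (t : E) a
    rw [h, fderivWithin_mul hD (differentiableWithinAt_extend f.2 t)
      (differentiableWithinAt_extend g.2 t)]
    rw [← h1 f.1, ← h1 g.1]
    simp

/-- The coefficient `η₀` in `φ^* η = η₀ dt¹ ∧ … ∧ dtⁿ`, for an `n`-form `η`. -/
noncomputable def GenCube.density {M : Type u} {C : DiffStructure M} {k n : ℕ}
    (φ : GenCube C n) (η : PointForm C k) (h : k = n) (t : φ.dom) : ℝ :=
  η.pullback φ.smooth t fun i =>
    tangentVector t (φ.uniqueDiffWithinAt t) (Pi.single (Fin.cast h i) 1)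

/-- `w` is a continuous extension of `f : D → ℝ` to `[0,1]^n` (uniquely determined by `f` on
`[0,1]^n` when `D` is dense there). -/
def IsContinuousExtension {n : ℕ} {D : Set (Fin n → ℝ)} (f : D → ℝ) (w : (Fin n → ℝ) → ℝ) :
    Prop :=
  ContinuousOn w (unitCube n) ∧ ∀ t : D, w t = f t

/-- The integral of the `k`-form `η` on the generalized `n`-cube `φ` exists: for `k = n` this
means that `φ^* η` has a continuous extension to `[0,1]^n`; for `k ≠ n` the integral is `0` by
convention. -/
def GenCube.IntegralExists {M : Type u} {C : DiffStructure M} {k n : ℕ}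
    (φ : GenCube C n) (η : PointForm C k) : Prop :=
  ∀ h : k = n, ∃ w, IsContinuousExtension (φ.density η h) w

open Classical in
/-- The integral of the `k`-form `η` on the generalized `n`-cube `φ`: the integral over `[0,1]^n`
of the continuous extension of `φ^* η` if `k = n`, and `0` if `k ≠ n`. -/
noncomputable def GenCube.integral {M : Type u} {C : DiffStructure M} {k n : ℕ}
    (φ : GenCube C n) (η : PointForm C k) : ℝ :=
  if h : k = n then
    if hw : ∃ w, IsContinuousExtension (φ.density η h) w then ∫ t in unitCube n, hw.choose t
    else 0
  else 0

/-- Smooth `n`-dimensional chains: finitely supported real functions on the set of cubes. -/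
abbrev Chain {M : Type u} (C : DiffStructure M) (n : ℕ) : Type u := GenCube C n →₀ ℝ

/-- The integral of `η` exists on every cube of the support of `Φ`. -/
def Chain.IntegralExists {M : Type u} {C : DiffStructure M} {k n : ℕ}
    (Φ : Chain C n) (η : PointForm C k) : Prop :=
  ∀ φ ∈ Φ.support, φ.IntegralExists η

/-- `∫_Φ η = ∑ cⱼ ∫_{φⱼ} η` for `Φ = ∑ cⱼ φⱼ`. -/
noncomputable def Chain.integral {M : Type u} {C : DiffStructure M} {k n : ℕ}
    (Φ : Chain C n) (η : PointForm C k) : ℝ :=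
  Φ.sum fun φ c => c * φ.integral η

/-! ### Uniform structures and completions -/

/-- The set `M`, with the uniform structure `𝒰_G`: the weakest one for which all functions of
the family `G` are uniformly continuous. -/
def UnifSpace {M : Type u} (_G : Set (M → ℝ)) : Type u := M

instance {M : Type u} (G : Set (M → ℝ)) : UniformSpace (UnifSpace G) :=
  ⨅ g ∈ G, UniformSpace.comap (fun x : M => g x) inferInstance

/-- The identity map of `M` into the uniform space `(M, 𝒰_G)`. -/
def toUnif {M : Type u} (G : Set (M → ℝ)) (m : M) : UnifSpace G := m

theorem uniformContinuous_of_mem {M : Type u} {G : Set (M → ℝ)} {g : M → ℝ} (hg : g ∈ G) :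
    UniformContinuous (fun x : UnifSpace G => g x) :=
  uniformContinuous_iff_le_comap.2 (iInf₂_le g hg)

theorem uniformContinuous_rng {X : Type v} [UniformSpace X] {M : Type u} {G : Set (M → ℝ)}
    {F : X → UnifSpace G} (h : ∀ g ∈ G, UniformContinuous fun x => g (F x)) :
    UniformContinuous F := by
  refine uniformContinuous_iInf_rng.2 fun g => uniformContinuous_iInf_rng.2 fun hg => ?_
  exact uniformContinuous_comap' (h g hg)

/-- The (Hausdorff) completion of the uniform space `(M, 𝒰_G)`. -/
abbrev Compl {M : Type u} (G : Set (M → ℝ)) : Type u := UniformSpace.Completion (UnifSpace G)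

/-- The natural map `ι` of `M` into the completion. -/
def toCompl {M : Type u} (G : Set (M → ℝ)) (m : M) : Compl G :=
  UniformSpace.Completion.coe' (toUnif G m)

/-- The continuous extension to the completion of a function on `M` that is uniformly continuous
for `𝒰_G`. -/
noncomputable def extendToCompl {M : Type u} (G : Set (M → ℝ)) (g : M → ℝ) : Compl G → ℝ :=
  UniformSpace.Completion.extension fun x : UnifSpace G => g x

/-- The differential structure of the completion, generated by the extensions of the members
of `G`. -/
noncomputable def complStructure {M : Type u} (G : Set (M → ℝ)) : DiffStructure (Compl G) :=
  generate {h | ∃ g ∈ G, h = extendToCompl G g}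

theorem extendToCompl_toCompl {M : Type u} {G : Set (M → ℝ)} {g : M → ℝ} (hg : g ∈ G) (m : M) :
    extendToCompl G g (toCompl G m) = g m :=
  UniformSpace.Completion.extension_coe (uniformContinuous_of_mem hg) _

theorem smoothMap_toCompl {M : Type u} {C : DiffStructure M} {G : Set (M → ℝ)}
    (hG : C = generate G) : SmoothMap C (complStructure G) (toCompl G) := by
  refine smoothMap_generate ?_
  rintro _ ⟨g, hg, rfl⟩
  have h : extendToCompl G g ∘ toCompl G = g := funext fun m => extendToCompl_toCompl hg m
  rw [h, hG]
  exact subset_generate G hg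

/-! ### Smoothly extendable cubes, chains and forms -/

/-- The family `{g ∘ π : g ∈ G} ∪ {dg : g ∈ G}` of functions on `TM`. -/
def tangentGenerators {M : Type u} (C : DiffStructure M) (G : Set (M → ℝ)) :
    Set (C.TangentBundle → ℝ) :=
  {h | ∃ g ∈ G, h = fun v => g v.1} ∪ {h | ∃ g : C.algebra, g.1 ∈ G ∧ h = C.diff g}

/-- The tangent map `Tφ : TD → TM`, with `TD` identified with `D × ℝⁿ`. -/
noncomputable def GenCube.tangentMap {M : Type u} {C : DiffStructure M} {n : ℕ}
    (φ : GenCube C n) (x : φ.dom × (Fin n → ℝ)) : C.TangentBundle :=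
  ⟨φ.toFun x.1, φ.smooth.tangentMap x.1 (tangentVector x.1 (φ.uniqueDiffWithinAt x.1) x.2)⟩

/-- The tangent bundle `[0,1]^n × ℝⁿ` of the interval `[0,1]^n`. -/
abbrev unitCubeTangent (n : ℕ) : Set ((Fin n → ℝ) × (Fin n → ℝ)) := unitCube n ×ˢ univ

/-- The cube `φ` is smoothly extendable with respect to `G`: its tangent map `Tφ` is uniformly
continuous on all sets `{(t, a) ∈ D × ℝⁿ : ‖a‖ ≤ R}`, for the uniform structure given on `TM` by
the functions `g ∘ π` and `dg` with `g ∈ G`, and its continuous extension to `[0,1]^n × ℝⁿ`, with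
values in the completion of `TM`, is smooth. -/
def GenCube.IsSmoothlyExtendable {M : Type u} {C : DiffStructure M} {n : ℕ}
    (G : Set (M → ℝ)) (φ : GenCube C n) : Prop :=
  (∀ R : ℝ, UniformContinuousOn
    (fun x => toUnif (tangentGenerators C G) (φ.tangentMap x)) {x | ‖x.2‖ ≤ R}) ∧
  ∃ ψ : unitCubeTangent n → Compl (tangentGenerators C G),
    Continuous ψ ∧
    (∀ x : φ.dom × (Fin n → ℝ), ψ ⟨(x.1, x.2), φ.dom_subset x.1.2, mem_univ _⟩ =
      toCompl (tangentGenerators C G) (φ.tangentMap x)) ∧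
    SmoothMap (smoothOn (unitCubeTangent n)) (complStructure (tangentGenerators C G)) ψ

/-- The chain `Φ` is smoothly extendable if all cubes of its support are. -/
def Chain.IsSmoothlyExtendable {M : Type u} {C : DiffStructure M} {n : ℕ}
    (G : Set (M → ℝ)) (Φ : Chain C n) : Prop :=
  ∀ φ ∈ Φ.support, φ.IsSmoothlyExtendable G

/-- The form `η` is smoothly extendable: it is the pullback of a smooth form on the completion. -/
def PointForm.IsSmoothlyExtendable {M : Type u} {C : DiffStructure M} {k : ℕ} {G : Set (M → ℝ)}
    (hG : C = generate G) (η : PointForm C k) : Prop :=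
  ∃ η' : PointForm (complStructure G) k, η'.IsSmooth ∧ η'.pullback (smoothMap_toCompl hG) = η

/-- A smoothly extendable cube has a continuous extension `[0,1]^n → compl_G M`, and this
extension is smooth. -/
theorem GenCube.IsSmoothlyExtendable.exists_extension {M : Type u} {C : DiffStructure M} {n : ℕ}
    {G : Set (M → ℝ)} {φ : GenCube C n} (h : φ.IsSmoothlyExtendable G) :
    ∃ φ' : unitCube n → Compl G, Continuous φ' ∧
      (∀ t : φ.dom, φ' ⟨t, φ.dom_subset t.2⟩ = toCompl G (φ.toFun t)) ∧
      SmoothMap (smoothOn (unitCube n)) (complStructure G) φ' := by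
  obtain ⟨-, ψ, hc, he, hs⟩ := h
  let T := tangentGenerators C G
  have hT : ∀ g ∈ G, (fun v : C.TangentBundle => g v.1) ∈ T := fun g hg => Or.inl ⟨g, hg, rfl⟩
  let π : UnifSpace T → UnifSpace G := fun v => Sigma.fst (β := fun m => C.Tangent m) v
  have hπ : UniformContinuous π :=
    uniformContinuous_rng fun g hg => uniformContinuous_of_mem (hT g hg)
  let π' : Compl T → Compl G := UniformSpace.Completion.map π
  have hπ' : ∀ g ∈ G, extendToCompl G g ∘ π' = extendToCompl T fun v => g v.1 := by
    intro g hg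
    have := UniformSpace.Completion.extension_map
      (f := fun x : UnifSpace G => g x) (uniformContinuous_of_mem hg) hπ
    exact this
  let j : unitCube n → unitCubeTangent n := fun t => ⟨(t, 0), t.2, mem_univ _⟩
  have hj : Continuous j := by fun_prop
  refine ⟨fun t => π' (ψ (j t)), UniformSpace.Completion.continuous_map.comp (hc.comp hj), ?_, ?_⟩
  · intro t
    have h1 := he (t, 0)
    change π' (ψ ⟨(t, 0), _⟩) = _
    rw [h1]
    exact UniformSpace.Completion.map_coe hπ _
  · refine smoothMap_generate ?_
    rintro _ ⟨g, hg, rfl⟩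
    have h2 : extendToCompl G g ∘ (fun t => π' (ψ (j t))) =
        (extendToCompl T (fun v => g v.1) ∘ ψ) ∘ j := by
      rw [← hπ' g hg]
      rfl
    rw [h2]
    have h3 := hs _ (subset_generate _ ⟨_, hT g hg, rfl⟩)
    intro t
    obtain ⟨U, hU, F, hF, hfF⟩ := h3 (j t)
    refine ⟨(fun x => (x, 0)) ⁻¹' U, ?_, fun x => F (x, 0), ?_, ?_⟩
    · exact (Continuous.prodMk_left (0 : Fin n → ℝ)).continuousAt hU
    · exact hF.comp (contDiff_id.prodMk contDiff_const)
    · intro y hy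
      exact hfF (j y) hy

/-- The extension `φ̃ : [0,1]^n → compl_G M` of a smoothly extendable cube. -/
noncomputable def GenCube.extension {M : Type u} {C : DiffStructure M} {n : ℕ}
    {G : Set (M → ℝ)} (φ : GenCube C n) (h : φ.IsSmoothlyExtendable G) :
    unitCube n → Compl G :=
  h.exists_extension.choose

theorem GenCube.smoothMap_extension {M : Type u} {C : DiffStructure M} {n : ℕ}
    {G : Set (M → ℝ)} (φ : GenCube C n) (h : φ.IsSmoothlyExtendable G) :
    SmoothMap (smoothOn (unitCube n)) (complStructure G) (φ.extension h) :=
  h.exists_extension.choose_spec.2.2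

/-! ### The boundary -/

/-- The map `I_{(i,a)} : [0,1]^n → [0,1]^{n+1}` that inserts the value `a` (equal to `0` or `1`)
at the place `i`. -/
def faceMap {n : ℕ} (i : Fin (n + 1)) (a : Fin 2) (x : unitCube n) : unitCube (n + 1) :=
  ⟨i.insertNth (α := fun _ => ℝ) (a : ℕ) x, by
    have ha : ((a : ℕ) : ℝ) ∈ Icc (0 : ℝ) 1 := by fin_cases a <;> simp
    rw [unitCube, ← pi_univ_Icc]
    intro l _
    refine Fin.succAboveCases i ?_ (fun l => ?_) l
    · simpa using ha
    · simpa using ⟨x.2.1 l, x.2.2 l⟩⟩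

theorem contDiff_insertNth {n : ℕ} (i : Fin (n + 1)) (a : ℝ) :
    ContDiff ℝ ∞ fun x : Fin n → ℝ => i.insertNth (α := fun _ => ℝ) a x := by
  refine contDiff_pi.2 fun l => ?_
  refine Fin.succAboveCases i ?_ (fun l => ?_) l
  · simpa using contDiff_const
  · simpa using contDiff_apply ℝ ℝ l

theorem smoothMap_faceMap {n : ℕ} (i : Fin (n + 1)) (a : Fin 2) :
    SmoothMap (smoothOn (unitCube n)) (smoothOn (unitCube (n + 1))) (faceMap i a) := by
  intro f hf t
  obtain ⟨U, hU, F, hF, hfF⟩ := hf (faceMap i a t)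
  have h := contDiff_insertNth i ((a : ℕ) : ℝ)
  exact ⟨_, h.continuous.continuousAt hU, _, hF.comp h, fun y hy => hfF (faceMap i a y) hy⟩

/-- The face `φ̃ ∘ I_{(i,a)}`, an `n`-dimensional cube in the completion. -/
noncomputable def GenCube.face {M : Type u} {C : DiffStructure M} {n : ℕ}
    {G : Set (M → ℝ)} (φ : GenCube C (n + 1)) (h : φ.IsSmoothlyExtendable G)
    (i : Fin (n + 1)) (a : Fin 2) : GenCube (complStructure G) n where
  dom := unitCube n
  dom_subset := Subset.rfl
  dense := subset_closure
  toFun := φ.extension h ∘ faceMap i a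
  smooth := fun f hf => smoothMap_faceMap i a _ (φ.smoothMap_extension h f hf)

/-- The boundary `∂_G φ = ∑ᵢ ∑ₐ (-1)^{i+a} φ̃ ∘ I_{(i,a)}`, where `i` runs from `1` to the dimension
of the cube (the index `i` of the code starts from `0`). -/
noncomputable def GenCube.boundary {M : Type u} {C : DiffStructure M} {n : ℕ}
    {G : Set (M → ℝ)} (φ : GenCube C (n + 1)) (h : φ.IsSmoothlyExtendable G) :
    Chain (complStructure G) n :=
  ∑ i : Fin (n + 1), ∑ a : Fin 2,
    Finsupp.single (φ.face h i a) ((-1 : ℝ) ^ ((i : ℕ) + 1 + (a : ℕ)))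

open Classical in
/-- The boundary `∂_G Φ = ∑ cⱼ ∂_G φⱼ` of a smoothly extendable chain `Φ = ∑ cⱼ φⱼ`. -/
noncomputable def Chain.boundary {M : Type u} {C : DiffStructure M} {n : ℕ}
    (G : Set (M → ℝ)) (Φ : Chain C (n + 1)) : Chain (complStructure G) n :=
  Φ.sum fun φ c => if h : φ.IsSmoothlyExtendable G then c • φ.boundary h else 0

/-! ### The cube `[-1,1]^ι` and the exterior derivative on it -/

/-- The product `[-1,1]^ι`. -/
abbrev Box (ι : Type v) : Type v := ι → Icc (-1 : ℝ) 1

/-- The differential structure `C^∞([-1,1]^ι)`, generated by the coordinate functions. -/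
def boxStructure (ι : Type v) : DiffStructure (Box ι) :=
  generate {h | ∃ i, h = fun x => (x i : ℝ)}

/-- The map `x ↦ (g(x))_{g ∈ G}` of `M` into `[-1,1]^G`. -/
def toBox {M : Type u} {G : Set (M → ℝ)} (hb : ∀ g ∈ G, ∀ x, |g x| ≤ 1) (x : M) : Box G :=
  fun g => ⟨g.1 x, abs_le.1 (hb g.1 g.2 x)⟩

theorem smoothMap_toBox {M : Type u} {C : DiffStructure M} {G : Set (M → ℝ)}
    (hG : C = generate G) (hb : ∀ g ∈ G, ∀ x, |g x| ≤ 1) :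
    SmoothMap C (boxStructure G) (toBox hb) := by
  refine smoothMap_generate ?_
  rintro _ ⟨g, rfl⟩
  rw [hG]
  exact subset_generate G g.2

/-- The line through `x` in the direction of the coordinate `i`, with parameter in `[-1,1]`. -/
noncomputable def boxLine {ι : Type v} (x : Box ι) (i : ι) (s : ℝ) : Box ι :=
  open Classical in Function.update x i (projIcc (-1 : ℝ) 1 (by norm_num) s)

/-- The partial derivative `∂f/∂xⁱ` (one-sided at the ends of `[-1,1]`). -/
noncomputable def boxPartial {ι : Type v} (i : ι) (f : Box ι → ℝ) (x : Box ι) : ℝ :=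
  derivWithin (fun s => f (boxLine x i s)) (Icc (-1) 1) (x i : ℝ)

theorem box_local {ι : Type v} {f : Box ι → ℝ} (hf : f ∈ (boxStructure ι).carrier) (x : Box ι) :
    ∃ U ∈ 𝓝 x, ∃ (n : ℕ) (l : Fin n → ι) (σ : (Fin n → ℝ) → ℝ), ContDiff ℝ ∞ σ ∧
      ∀ y ∈ U, f y = σ fun j => (y (l j) : ℝ) := by
  obtain ⟨U, hU, hx, n, g, hg, σ, hσ, hfσ⟩ := hf x
  choose l hl using hg
  have hle : (inferInstance : TopologicalSpace (Box ι)) ≤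
      initialTopology {h : Box ι → ℝ | ∃ i, h = fun x => (x i : ℝ)} := by
    refine le_initialTopology ?_
    rintro _ ⟨i, rfl⟩
    fun_prop
  refine ⟨U, IsOpen.mem_nhds (hle U hU) hx, n, l, σ, hσ, fun y hy => ?_⟩
  simp [hfσ y hy, hl]

theorem box_mem_of_local {ι : Type v} {f : Box ι → ℝ}
    (h : ∀ x : Box ι, ∃ U ∈ 𝓝 x, ∃ (n : ℕ) (l : Fin n → ι) (σ : (Fin n → ℝ) → ℝ),
      ContDiff ℝ ∞ σ ∧ ∀ y ∈ U, f y = σ fun j => (y (l j) : ℝ)) :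
    f ∈ (boxStructure ι).carrier := by
  intro x
  obtain ⟨U, hU, n, l, σ, hσ, hfσ⟩ := h x
  obtain ⟨V, hVU, hV, hxV⟩ := mem_nhds_iff.1 hU
  have hle : initialTopology {h : Box ι → ℝ | ∃ i, h = fun x => (x i : ℝ)} ≤
      (inferInstance : TopologicalSpace (Box ι)) := by
    rw [← continuous_id_iff_le]
    let _ := initialTopology {h : Box ι → ℝ | ∃ i, h = fun x => (x i : ℝ)}
    refine continuous_pi fun i => ?_
    exact Continuous.subtype_mk (p := fun r => r ∈ Icc (-1 : ℝ) 1)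
      (f := fun x : Box ι => (x i : ℝ)) (continuous_of_mem (G := {h : Box ι → ℝ | ∃ i, h = fun x => (x i : ℝ)})
        ⟨i, rfl⟩) fun x => (x i).2
  exact ⟨V, hle V hV, hxV, n, fun j y => y (l j), fun j => ⟨l j, rfl⟩, σ, hσ,
    fun y hy => hfσ y (hVU hy)⟩

theorem boxLine_self {ι : Type v} (x : Box ι) (i : ι) : boxLine x i (x i : ℝ) = x := by
  classical
  simp [boxLine]

theorem continuous_boxLine {ι : Type v} (x : Box ι) (i : ι) : Continuous (boxLine x i) := by
  classical
  unfold boxLine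
  exact continuous_const.update i continuous_projIcc

open Classical in
theorem hasDerivWithinAt_boxLine {ι : Type v} {f : Box ι → ℝ} {x : Box ι} {U : Set (Box ι)}
    (hU : U ∈ 𝓝 x) {n : ℕ} {l : Fin n → ι} {σ : (Fin n → ℝ) → ℝ} (hσ : ContDiff ℝ ∞ σ)
    (hf : ∀ y ∈ U, f y = σ fun j => (y (l j) : ℝ)) (i : ι) :
    HasDerivWithinAt (fun s => f (boxLine x i s))
      (fderiv ℝ σ (fun j => (x (l j) : ℝ)) fun j => if l j = i then 1 else 0)
      (Icc (-1) 1) (x i : ℝ) := by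
  let γ : ℝ → Fin n → ℝ := fun s j => if l j = i then s else x (l j)
  have hγ0 : γ (x i) = fun j => (x (l j) : ℝ) := by
    funext j
    by_cases h : l j = i
    · simp [γ, h]
    · simp [γ, h]
  have hγ : HasDerivAt γ (fun j => if l j = i then 1 else 0) (x i : ℝ) := by
    refine hasDerivAt_pi.2 fun j => ?_
    by_cases h : l j = i
    · simpa [γ, h] using hasDerivAt_id' (x i : ℝ)
    · simpa [γ, h] using hasDerivAt_const (x i : ℝ) (x (l j) : ℝ)
  have hσ' : HasFDerivAt σ (fderiv ℝ σ (fun j => (x (l j) : ℝ))) (γ (x i)) := by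
    rw [hγ0]
    exact ((hσ.differentiable (by simp)) _).hasFDerivAt
  have h1 := (hσ'.comp_hasDerivAt (x i : ℝ) hγ).hasDerivWithinAt (s := Icc (-1) 1)
  have key : ∀ s ∈ Icc (-1 : ℝ) 1, boxLine x i s ∈ U → f (boxLine x i s) = σ (γ s) := by
    intro s hs hsU
    rw [hf _ hsU]
    congr 1
    funext j
    by_cases h : l j = i
    · simp only [γ, h, if_true, boxLine, Function.update_self]
      rw [projIcc_of_mem _ hs]
    · simp [γ, h, boxLine]
  refine h1.congr_of_eventuallyEq ?_ ?_
  · have h2 : boxLine x i ⁻¹' U ∈ 𝓝 (x i : ℝ) :=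
      (continuous_boxLine x i).continuousAt (by rwa [boxLine_self])
    filter_upwards [self_mem_nhdsWithin, mem_nhdsWithin_of_mem_nhds h2] with s hs hsU
    exact key s hs hsU
  · exact key _ (x i).2 (by rw [boxLine_self]; exact mem_of_mem_nhds hU)

theorem differentiableWithinAt_boxLine {ι : Type v} {f : Box ι → ℝ}
    (hf : f ∈ (boxStructure ι).carrier) (x : Box ι) (i : ι) :
    DifferentiableWithinAt ℝ (fun s => f (boxLine x i s)) (Icc (-1) 1) (x i : ℝ) := by
  obtain ⟨U, hU, n, l, σ, hσ, hfσ⟩ := box_local hf x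
  exact (hasDerivWithinAt_boxLine hU hσ hfσ i).differentiableWithinAt

theorem uniqueDiffWithinAt_Icc {ι : Type v} (x : Box ι) (i : ι) :
    UniqueDiffWithinAt ℝ (Icc (-1 : ℝ) 1) (x i : ℝ) :=
  uniqueDiffOn_Icc (by norm_num) _ (x i).2

open Classical in
theorem boxPartial_eq {ι : Type v} {f : Box ι → ℝ} {x : Box ι} {U : Set (Box ι)}
    (hU : U ∈ 𝓝 x) {n : ℕ} {l : Fin n → ι} {σ : (Fin n → ℝ) → ℝ} (hσ : ContDiff ℝ ∞ σ)
    (hf : ∀ y ∈ U, f y = σ fun j => (y (l j) : ℝ)) (i : ι) :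
    boxPartial i f x =
      fderiv ℝ σ (fun j => (x (l j) : ℝ)) fun j => if l j = i then 1 else 0 :=
  (hasDerivWithinAt_boxLine hU hσ hf i).derivWithin (uniqueDiffWithinAt_Icc x i)

theorem finite_support_boxPartial {ι : Type v} {f : Box ι → ℝ}
    (hf : f ∈ (boxStructure ι).carrier) (x : Box ι) (a : ι → ℝ) :
    (Function.support fun i => a i * boxPartial i f x).Finite := by
  obtain ⟨U, hU, n, l, σ, hσ, hfσ⟩ := box_local hf x
  refine (finite_range l).subset fun i hi => ?_
  classical
  by_contra h
  refine hi ?_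
  have h1 : (fun j => if l j = i then (1 : ℝ) else 0) = 0 := by
    funext j
    exact if_neg fun hj => h ⟨j, hj⟩
  simp only
  rw [boxPartial_eq hU hσ hfσ i]
  convert mul_zero (a i)
  convert (fderiv ℝ σ fun j => (x (l j) : ℝ)).map_zero

/-- The tangent vector `∑ᵢ aᵢ ∂/∂xⁱ` at the point `x` of `[-1,1]^ι` (only finitely many terms of
the sum are different from zero on a given smooth function). -/
noncomputable def boxVector {ι : Type v} (x : Box ι) (a : ι → ℝ) :
    (boxStructure ι).Tangent x where
  val :=
    { toFun := fun f => ∑ᶠ i, a i * boxPartial i f.1 x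
      map_add' := by
        intro f g
        rw [← finsum_add_distrib (finite_support_boxPartial f.2 x a)
          (finite_support_boxPartial g.2 x a)]
        refine finsum_congr fun i => ?_
        rw [← mul_add]
        congr 1
        exact derivWithin_add (differentiableWithinAt_boxLine f.2 x i)
          (differentiableWithinAt_boxLine g.2 x i)
      map_smul' := by
        intro c f
        rw [RingHom.id_apply, smul_eq_mul, mul_finsum]
        refine finsum_congr fun i => ?_
        have h : boxPartial i (c • f).1 x = c * boxPartial i f.1 x :=
          derivWithin_const_mul c (differentiableWithinAt_boxLine f.2 x i)
        rw [h]
        ring }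
  property := by
    intro f g
    change ∑ᶠ i, a i * boxPartial i (f * g).1 x =
      f.1 x * ∑ᶠ i, a i * boxPartial i g.1 x + g.1 x * ∑ᶠ i, a i * boxPartial i f.1 x
    have hf := finite_support_boxPartial f.2 x a
    have hg := finite_support_boxPartial g.2 x a
    rw [mul_finsum, mul_finsum, ← finsum_add_distrib]
    · refine finsum_congr fun i => ?_
      have h := derivWithin_mul (differentiableWithinAt_boxLine f.2 x i)
        (differentiableWithinAt_boxLine g.2 x i)
      have h' : boxPartial i (f * g).1 x =
          boxPartial i f.1 x * g.1 x + f.1 x * boxPartial i g.1 x := by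
        simp only [boxLine_self] at h
        exact h
      rw [h']
      ring
    · exact hg.subset fun i hi h => hi (by simp [h])
    · exact hf.subset fun i hi h => hi (by simp [h])

theorem boxVector_apply {ι : Type v} {f : (boxStructure ι).algebra} {x : Box ι}
    {U : Set (Box ι)} (hU : U ∈ 𝓝 x) {n : ℕ} {l : Fin n → ι} {σ : (Fin n → ℝ) → ℝ}
    (hσ : ContDiff ℝ ∞ σ) (hf : ∀ y ∈ U, f.1 y = σ fun j => (y (l j) : ℝ)) (a : ι → ℝ) :
    (boxVector x a).1 f = fderiv ℝ σ (fun j => (x (l j) : ℝ)) fun j => a (l j) := by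
  classical
  change ∑ᶠ i, a i * boxPartial i f.1 x = _
  have hs : (Function.support fun i => a i * boxPartial i f.1 x) ⊆
      ((Finset.univ.image l : Finset ι) : Set ι) := by
    intro i hi
    by_contra h
    refine hi ?_
    have h1 : (fun j => if l j = i then (1 : ℝ) else 0) = 0 := by
      funext j
      exact if_neg fun hj => h (by simp [← hj])
    simp only
    rw [boxPartial_eq hU hσ hf i, h1]
    simp
  rw [finsum_eq_sum_of_support_subset _ hs]
  have h2 : ∀ i, a i * boxPartial i f.1 x =
      fderiv ℝ σ (fun j => (x (l j) : ℝ)) (fun j => if l j = i then a (l j) else 0) := by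
    intro i
    rw [boxPartial_eq hU hσ hf i, ← smul_eq_mul, ← map_smul]
    congr 1
    funext j
    by_cases h : l j = i
    · simp [h]
    · simp [h]
  simp only [h2]
  rw [← map_sum]
  congr 1
  funext j
  simp

/-- The coordinates `v(xⁱ)` of a tangent vector of `[-1,1]^ι`. -/
def boxCoord {ι : Type v} {x : Box ι} (v : (boxStructure ι).Tangent x) (i : ι) : ℝ :=
  v.1 ⟨fun x => (x i : ℝ), subset_generate _ ⟨i, rfl⟩⟩

/-- The function `ω(X₁, …, X_k)` for the constant vector fields `X_j` with coordinates `a_j`. -/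
noncomputable def PointForm.onConstFields {ι : Type v} {k : ℕ} (η : PointForm (boxStructure ι) k)
    (a : Fin k → ι → ℝ) (x : Box ι) : ℝ :=
  η x fun j => boxVector x (a j)

theorem boxVector_smooth {ι : Type v} (a : ι → ℝ) (f : (boxStructure ι).algebra) :
    (fun x => (boxVector x a).1 f) ∈ (boxStructure ι).carrier := by
  refine box_mem_of_local fun x => ?_
  obtain ⟨U, hU, n, l, σ, hσ, hfσ⟩ := box_local f.2 x
  refine ⟨interior U, interior_mem_nhds.2 hU, n, l,
    fun z => fderiv ℝ σ z fun j => a (l j), ?_, fun y hy => ?_⟩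
  · exact (hσ.fderiv_right (m := ∞) (by simp)).clm_apply contDiff_const
  · exact boxVector_apply (mem_interior_iff_mem_nhds.1 hy) hσ hfσ a

theorem PointForm.onConstFields_smooth {ι : Type v} {k : ℕ} {η : PointForm (boxStructure ι) k}
    (hη : η.IsSmooth) (a : Fin k → ι → ℝ) :
    η.onConstFields a ∈ (boxStructure ι).carrier := by
  have h : SmoothMap (boxStructure ι) ((boxStructure ι).tangentPowerStructure k)
      fun x => ⟨x, fun j => boxVector x (a j)⟩ := by
    refine smoothMap_generate ?_
    rintro _ (⟨α, hα, rfl⟩ | ⟨α, i, rfl⟩)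
    · exact hα
    · exact boxVector_smooth (a i) α
  exact h _ hη

theorem boxVector_add {ι : Type v} (x : Box ι) (a b : ι → ℝ) :
    boxVector x (a + b) = boxVector x a + boxVector x b := by
  refine Subtype.ext (LinearMap.ext fun f => ?_)
  obtain ⟨U, hU, n, l, σ, hσ, hfσ⟩ := box_local f.2 x
  change (boxVector x (a + b)).1 f = (boxVector x a).1 f + (boxVector x b).1 f
  rw [boxVector_apply hU hσ hfσ, boxVector_apply hU hσ hfσ, boxVector_apply hU hσ hfσ, ← map_add]
  rfl

theorem boxVector_smul {ι : Type v} (x : Box ι) (c : ℝ) (a : ι → ℝ) :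
    boxVector x (c • a) = c • boxVector x a := by
  refine Subtype.ext (LinearMap.ext fun f => ?_)
  obtain ⟨U, hU, n, l, σ, hσ, hfσ⟩ := box_local f.2 x
  change (boxVector x (c • a)).1 f = c • (boxVector x a).1 f
  rw [boxVector_apply hU hσ hfσ, boxVector_apply hU hσ hfσ, ← map_smul]
  rfl

/-- The parallel translation `T_x → T_y` in `[-1,1]^ι`: the value at `y` of the constant vector field
with value `v` at `x`. -/
noncomputable def boxTranslate {ι : Type v} (x y : Box ι) :
    (boxStructure ι).Tangent x →ₗ[ℝ] (boxStructure ι).Tangent y where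
  toFun v := boxVector y (boxCoord v)
  map_add' v w := boxVector_add y (boxCoord v) (boxCoord w)
  map_smul' c v := boxVector_smul y c (boxCoord v)

/-- The alternating map `(w₁, …, w_k) ↦ v(η(W₁, …, W_k))`, where `v, w₁, …, w_k` are tangent vectors
at `x` and `W_j` is the constant vector field with value `w_j` at `x`. -/
noncomputable def PointForm.derivAlong {ι : Type v} {k : ℕ} {η : PointForm (boxStructure ι) k}
    (hη : η.IsSmooth) {x : Box ι} (v : (boxStructure ι).Tangent x) :
    ((boxStructure ι).Tangent x) [⋀^Fin k]→ₗ[ℝ] ℝ where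
  toFun w := v.1 ⟨η.onConstFields fun j => boxCoord (w j), PointForm.onConstFields_smooth hη _⟩
  map_update_add' w i a b := by
    rw [← map_add]
    congr 1
    exact Subtype.ext (funext fun y =>
      ((η y).compLinearMap (boxTranslate x y)).map_update_add w i a b)
  map_update_smul' w i c a := by
    rw [← map_smul]
    congr 1
    exact Subtype.ext (funext fun y =>
      ((η y).compLinearMap (boxTranslate x y)).map_update_smul w i c a)
  map_eq_zero_of_eq' w i j hij hne := by
    rw [← map_zero v.1]
    congr 1
    exact Subtype.ext (funext fun y =>
      ((η y).compLinearMap (boxTranslate x y)).map_eq_zero_of_eq w hij hne)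

/-- The exterior derivative on `[-1,1]^ι`:
`(dη)(v₀, …, v_k) = ∑ᵢ (-1)^i vᵢ(η(V₀, …, V̂ᵢ, …, V_k))`, where `V_j` is the constant vector field
through `v_j` (the terms with brackets `[Vᵢ, V_j]` vanish for constant vector fields). -/
noncomputable def PointForm.extDeriv {ι : Type v} {k : ℕ} (η : PointForm (boxStructure ι) k)
    (hη : η.IsSmooth) : PointForm (boxStructure ι) (k + 1) := fun x =>
  AlternatingMap.alternatizeUncurryFin
    { toFun := fun v => PointForm.derivAlong hη (x := x) v
      map_add' := fun _ _ => rfl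
      map_smul' := fun _ _ => rfl }

end DiffSpace

namespace DiffSpace

universe u v w

/-! ### An identity for alternating maps -/

/-! Since the members of G are bounded by 1, so are their extensions to the completion, which
therefore map `compl_G M` into [-1,1]^G (`complToBox`). The extension of a smoothly extendable cube
φ becomes a smooth map f : [0,1]^{n+1} → [-1,1]^G (`GenCube.boxExtension`), and for forms of degree
n the theorem reduces to the classical Stokes theorem for f.

On the cube, take the vector field with components (-1)ʲ η̃(∂₀f, …, omit ∂ⱼf, …, ∂ₙf). By the chain
rule (`PointForm.exists_hasFDerivAt_onConstFields`), its divergence splits into derivatives of η̃ in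
the base point, which add up to dη̃(∂₀f, …, ∂ₙf), and terms in which one tangent vector is
differentiated. The latter contain ∂ⱼ∂ₗf, symmetric in j and l, inside an alternating sum, and they
cancel. The divergence theorem then gives `integral_extDeriv_cubeFrame`. The infinite number of
coordinates does no harm: by smoothness, η̃ evaluated on constant fields depends locally on finitely
many coordinates of the point and of the vectors (`smoothMap_frame`, `frame_local`).

The boundary lives in the completion and carries η', not η̃. Both η' and the pullback of η̃ to the
completion restrict to η on M, so they agree on the tangent vectors of the extended cube over the
dense domain of φ. Both are continuous along the extended cube, so they agree over the whole cube,
in particular on its faces (`PointForm.along_eq_of_pullback_eq`, `GenCube.density_face`). This also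
shows that the left side does not depend on η'.

If the degree of the form is not n, both sides are 0 by convention. -/

theorem sum_neg_one_pow_update_removeNth_eq_zero {W : Type*} [AddCommGroup W] [Module ℝ W] {n : ℕ}
    (m : W [⋀^Fin n]→ₗ[ℝ] ℝ) (a : Fin (n + 1) → W) (b : Fin (n + 1) → Fin (n + 1) → W)
    (hb : ∀ i j, b i j = b j i) :
    ∑ j : Fin (n + 1), (-1 : ℝ) ^ (j : ℕ) *
      ∑ i : Fin n, m (Function.update (j.removeNth a) i (b j (j.succAbove i))) = 0 := by
  rcases n with _ | n
  · simp
  -- Moving the replaced argument to the front costs the sign (-1)ⁱ.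
  have hupd : ∀ (w : Fin (n + 1) → W) (i : Fin (n + 1)) (x : W),
      m (Function.update w i x) = (-1 : ℝ) ^ (i : ℕ) * m (Matrix.vecCons x (i.removeNth w)) := by
    intro w i x
    rw [← Fin.insertNth_removeNth, AlternatingMap.map_insertNth]
    simp
  simp only [Finset.mul_sum]
  -- The pairs of distinct indices are grouped as (j, l), (l, j). Both terms have the same remaining
  -- arguments and, by symmetry of `b`, the same first argument; the shift of the larger index after
  -- the smaller one is removed makes their signs opposite.
  rw [Fin.sum_sum_eq_sum_triangle_add]
  refine Finset.sum_eq_zero fun i _ => Finset.sum_eq_zero fun j hj => ?_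
  rw [Finset.mem_Ici] at hj
  have H₁ : i.castSucc.succAbove j = j.succ := by simp [Fin.succAbove_of_le_castSucc, hj]
  have H₂ : j.predAbove i.castSucc = i := by simp [Fin.predAbove_of_le_castSucc, hj]
  have H₃ : j.succ.succAbove i = i.castSucc := by simp [Fin.succAbove_of_castSucc_lt, hj]
  rw [hupd, hupd, Fin.removeNth_removeNth_eq_swap, H₁, H₂, H₃, hb j.succ]
  simp only [Fin.val_castSucc, Fin.val_succ, pow_succ]
  ring

/-! ### Forms on the box in terms of finitely many coordinates -/

/-- The constant vector fields, as a linear map into the tangent space. -/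
noncomputable def boxVectorLinear {ι : Type v} (x : Box ι) :
    (ι → ℝ) →ₗ[ℝ] (boxStructure ι).Tangent x where
  toFun := boxVector x
  map_add' := boxVector_add x
  map_smul' := boxVector_smul x

/-- The alternating map `a ↦ η(X₁, …, X_k)` at `x`, for constant vector fields with coordinates `a`. -/
noncomputable def PointForm.onCoords {ι : Type v} {k : ℕ} (η : PointForm (boxStructure ι) k)
    (x : Box ι) : (ι → ℝ) [⋀^Fin k]→ₗ[ℝ] ℝ :=
  (η x).compLinearMap (boxVectorLinear x)

theorem PointForm.onCoords_apply {ι : Type v} {k : ℕ} (η : PointForm (boxStructure ι) k)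
    (x : Box ι) (a : Fin k → ι → ℝ) : η.onCoords x a = η.onConstFields a x := rfl

/-- The coordinates of a point of `[-1,1]^ι` together with `k` coordinate vectors. -/
def frameCoord {ι : Type v} {k : ℕ} : ι ⊕ (Fin k × ι) → Box ι × (Fin k → ι → ℝ) → ℝ
  | .inl i, z => z.1 i
  | .inr p, z => z.2 p.1 p.2

theorem continuous_frameCoord {ι : Type v} {k : ℕ} (c : ι ⊕ (Fin k × ι)) :
    Continuous (frameCoord c) := by
  rcases c with i | p
  · exact continuous_subtype_val.comp ((continuous_apply i).comp continuous_fst)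
  · exact (continuous_apply p.2).comp ((continuous_apply p.1).comp continuous_snd)

/-- The differential structure generated by the coordinates `frameCoord`. -/
def frameStructure (ι : Type v) (k : ℕ) : DiffStructure (Box ι × (Fin k → ι → ℝ)) :=
  generate (range frameCoord)

theorem smoothMap_frame_fst (ι : Type v) (k : ℕ) :
    SmoothMap (frameStructure ι k) (boxStructure ι) Prod.fst := by
  refine smoothMap_generate ?_
  rintro _ ⟨i, rfl⟩
  exact subset_generate _ ⟨.inl i, rfl⟩

theorem frame_local {ι : Type v} {k : ℕ} {f : Box ι × (Fin k → ι → ℝ) → ℝ}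
    (hf : f ∈ (frameStructure ι k).carrier) (z : Box ι × (Fin k → ι → ℝ)) :
    ∃ U : Set (Box ι × (Fin k → ι → ℝ)), IsOpen U ∧ z ∈ U ∧
      ∃ (p : ℕ) (c : Fin p → ι ⊕ (Fin k × ι)) (τ : (Fin p → ℝ) → ℝ), ContDiff ℝ ∞ τ ∧
        ∀ y ∈ U, f y = τ fun m => frameCoord (c m) y := by
  obtain ⟨U, hU, hz, p, g, hg, τ, hτ, hfτ⟩ := hf z
  choose c hc using hg
  have hle : (inferInstance : TopologicalSpace (Box ι × (Fin k → ι → ℝ))) ≤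
      initialTopology (range frameCoord) := by
    refine le_initialTopology ?_
    rintro _ ⟨c, rfl⟩
    exact continuous_frameCoord c
  refine ⟨U, hle U hU, hz, p, c, τ, hτ, fun y hy => ?_⟩
  rw [hfτ y hy]
  simp only [hc]

/-- This turns smoothness of a form, a condition on abstract derivations, into smooth dependence on
the coordinates of the point and of the vectors. The reason is that dα of a constant field is
locally the derivative of a function σ of n coordinates, which is smooth in the n coordinates of the
point and the n coordinates of the vector. -/
theorem smoothMap_frame (ι : Type v) (k : ℕ) :
    SmoothMap (frameStructure ι k) ((boxStructure ι).tangentPowerStructure k)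
      fun z => ⟨z.1, fun j => boxVector z.1 (z.2 j)⟩ := by
  refine smoothMap_generate ?_
  rintro _ (⟨α, hα, rfl⟩ | ⟨α, j, rfl⟩)
  · exact smoothMap_frame_fst ι k α hα
  · refine (frameStructure ι k).local_mem _ fun z => ?_
    obtain ⟨U, hU, hx, n, g, hg, σ, hσ, hfσ⟩ := α.2 z.1
    choose l hl using hg
    obtain rfl : g = fun i x => (x (l i) : ℝ) := funext hl
    have hU' : IsOpen U := by
      have hle : (inferInstance : TopologicalSpace (Box ι)) ≤
          initialTopology {h : Box ι → ℝ | ∃ i, h = fun x => (x i : ℝ)} := by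
        refine le_initialTopology ?_
        rintro _ ⟨i, rfl⟩
        fun_prop
      exact hle U hU
    have hUf : IsOpen[initialTopology (frameStructure ι k).carrier] (Prod.fst ⁻¹' U) := by
      refine @Continuous.isOpen_preimage _ _ (initialTopology (frameStructure ι k).carrier)
        (initialTopology {h : Box ι → ℝ | ∃ i, h = fun x => (x i : ℝ)}) _ ?_ U hU
      refine continuous_rng ?_
      rintro _ ⟨i, rfl⟩
      exact continuous_of_mem (smoothMap_frame_fst ι k _ (subset_generate _ ⟨i, rfl⟩))
    refine ⟨_, hUf, hx, fun z => fderiv ℝ σ (fun i => (z.1 (l i) : ℝ)) fun i => z.2 j (l i), ?_, ?_⟩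
    -- The first n arguments are coordinates of the base point, the last n those of the j-th vector.
    · have := (frameStructure ι k).comp_mem (n + n)
        (fun u => fderiv ℝ σ (fun i => u (Fin.castAdd n i)) fun i => u (Fin.natAdd n i)) ?_
        (Fin.append (fun i => frameCoord (.inl (l i))) fun i => frameCoord (.inr (j, l i))) ?_
      · simp only [Fin.append_left, Fin.append_right] at this
        exact this
      · refine ((hσ.fderiv_right (m := ∞) (by simp)).comp ?_).clm_apply ?_
        · exact contDiff_pi.2 fun i => contDiff_apply ℝ ℝ _
        · exact contDiff_pi.2 fun i => contDiff_apply ℝ ℝ _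
      · intro i
        refine Fin.addCases (fun i => ?_) (fun i => ?_) i
        · rw [Fin.append_left]
          exact subset_generate _ ⟨_, rfl⟩
        · rw [Fin.append_right]
          exact subset_generate _ ⟨_, rfl⟩
    · intro y hy
      exact boxVector_apply (hU'.mem_nhds hy) hσ hfσ (y.2 j)

theorem PointForm.IsSmooth.onConstFields_mem {ι : Type v} {k : ℕ}
    {η : PointForm (boxStructure ι) k} (hη : η.IsSmooth) :
    (fun z : Box ι × (Fin k → ι → ℝ) => η.onConstFields z.2 z.1) ∈
      (frameStructure ι k).carrier :=
  smoothMap_frame ι k _ hη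

theorem continuous_of_mem_frameStructure {ι : Type v} {k : ℕ} {f : Box ι × (Fin k → ι → ℝ) → ℝ}
    (hf : f ∈ (frameStructure ι k).carrier) : Continuous f := by
  rw [continuous_iff_continuousAt]
  intro z
  obtain ⟨U, hU, hz, p, c, τ, hτ, h⟩ := frame_local hf z
  have h1 : Continuous fun y : Box ι × (Fin k → ι → ℝ) => τ fun m => frameCoord (c m) y :=
    hτ.continuous.comp (continuous_pi fun m => continuous_frameCoord _)
  refine h1.continuousAt.congr ?_
  filter_upwards [hU.mem_nhds hz] with y hy
  exact (h y hy).symm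

/-! ### Partial derivatives of a form in the base point and in its arguments -/

/-- The part of a list of coordinates of the tangent vector `(v, b)` at a point of
`[-1,1]^ι × (ℝ^ι)^k`. -/
def frameDir {ι : Type v} {k : ℕ} (v : ι → ℝ) (b : Fin k → ι → ℝ) : ι ⊕ (Fin k × ι) → ℝ
  | .inl i => v i
  | .inr p => b p.1 p.2

/-- With the vectors frozen, only the base coordinates among the arguments of `τ` vary; hence the
direction with zero vector part. -/
theorem boxVector_onConstFields {ι : Type v} {k : ℕ} {η : PointForm (boxStructure ι) k}
    (hη : η.IsSmooth) {U : Set (Box ι × (Fin k → ι → ℝ))} (hU : IsOpen U) {p : ℕ}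
    {c : Fin p → ι ⊕ (Fin k × ι)} {τ : (Fin p → ℝ) → ℝ} (hτ : ContDiff ℝ ∞ τ)
    (h : ∀ y ∈ U, η.onConstFields y.2 y.1 = τ fun m => frameCoord (c m) y)
    {z : Box ι × (Fin k → ι → ℝ)} (hz : z ∈ U) (v : ι → ℝ) :
    (boxVector z.1 v).1 ⟨η.onConstFields z.2, PointForm.onConstFields_smooth hη _⟩ =
      fderiv ℝ τ (fun m => frameCoord (c m) z) fun m => frameDir v 0 (c m) := by
  obtain ⟨x, b⟩ := z
  -- For a vector coordinate, the index chosen by `l` is a dummy: `ρ` discards that value and puts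
  -- in the constant entry of `b`.
  let l : Fin p → ι := fun m => (c m).elim id Prod.snd
  let ρ : (Fin p → ℝ) → Fin p → ℝ := fun u m =>
    match c m with
    | .inl _ => u m
    | .inr q => b q.1 q.2
  have hρm : ∀ m, ContDiff ℝ ∞ fun u => ρ u m := by
    intro m
    simp only [ρ]
    rcases c m with i | q
    · exact contDiff_apply ℝ ℝ m
    · exact contDiff_const
  have hρ : ContDiff ℝ ∞ ρ := contDiff_pi.2 hρm
  have hρf : ∀ y : Box ι, ρ (fun m => y (l m)) = fun m => frameCoord (c m) (y, b) := by
    intro y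
    funext m
    simp only [ρ, l]
    rcases c m with i | q <;> rfl
  have hρ' : ∀ u, HasFDerivAt ρ (fderiv ℝ ρ u) u := fun u =>
    (hρ.differentiable (by simp) u).hasFDerivAt
  have hV : (fun y : Box ι => (y, b)) ⁻¹' U ∈ 𝓝 x :=
    (Continuous.prodMk_left b).continuousAt (hU.mem_nhds hz)
  rw [boxVector_apply (f := ⟨η.onConstFields b, PointForm.onConstFields_smooth hη _⟩) hV
    (hτ.comp hρ) (l := l) ?_ v]
  · rw [fderiv_comp _ (hτ.differentiable (by simp) _) (hρ.differentiable (by simp) _), hρf]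
    simp only [ContinuousLinearMap.comp_apply]
    congr 1
    funext m
    have h1 := (hasFDerivAt_pi'.1 (hρ' fun m => (x (l m) : ℝ))) m
    have h2 : fderiv ℝ ρ (fun m => (x (l m) : ℝ)) (fun m => v (l m)) m =
        fderiv ℝ (fun u => ρ u m) (fun m => (x (l m) : ℝ)) (fun m => v (l m)) := by
      rw [h1.fderiv]
      rfl
    rw [h2]
    simp only [ρ, l]
    rcases hcm : c m with i | q
    · simp only [frameDir]
      have := (hasFDerivAt_apply (𝕜 := ℝ) m fun m => (x (l m) : ℝ)).fderiv
      simp only [l] at this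
      erw [this]
      simp [hcm]
    · simp [frameDir]
  · intro y hy
    simp only [Function.comp_apply]
    rw [hρf]
    exact h _ hy

/-- Joint continuity in the point, the frozen vectors and the direction is what makes the density of
the exterior derivative continuous up to the boundary of the cube. -/
theorem continuous_boxVector_onConstFields {ι : Type v} {k : ℕ} {η : PointForm (boxStructure ι) k}
    (hη : η.IsSmooth) : Continuous fun z : (Box ι × (Fin k → ι → ℝ)) × (ι → ℝ) =>
      (boxVector z.1.1 z.2).1 ⟨η.onConstFields z.1.2, PointForm.onConstFields_smooth hη _⟩ := by
  rw [continuous_iff_continuousAt]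
  rintro ⟨z, v⟩
  obtain ⟨U, hU, hz, p, c, τ, hτ, h⟩ := frame_local hη.onConstFields_mem z
  have h1 : Continuous fun y : (Box ι × (Fin k → ι → ℝ)) × (ι → ℝ) =>
      fderiv ℝ τ (fun m => frameCoord (c m) y.1) fun m => frameDir y.2 0 (c m) := by
    refine ((hτ.continuous_fderiv (by simp)).comp (continuous_pi fun m =>
      (continuous_frameCoord _).comp continuous_fst)).clm_apply (continuous_pi fun m => ?_)
    rcases c m with i | q
    · exact (continuous_apply i).comp continuous_snd
    · exact continuous_const
  refine h1.continuousAt.congr ?_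
  filter_upwards [continuous_fst.continuousAt (hU.mem_nhds hz)] with y hy
  exact (boxVector_onConstFields hη hU hτ h hy y.2).symm

/-- Along the line `b j + s • v` in the j-th slot the form is affine in `s` by multilinearity, with
slope its value with `v` in that slot. The chain rule for `τ` computes the same slope. -/
theorem PointForm.onConstFields_update {ι : Type v} {k : ℕ} {η : PointForm (boxStructure ι) k}
    {U : Set (Box ι × (Fin k → ι → ℝ))} (hU : IsOpen U) {p : ℕ}
    {c : Fin p → ι ⊕ (Fin k × ι)} {τ : (Fin p → ℝ) → ℝ} (hτ : ContDiff ℝ ∞ τ)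
    (h : ∀ y ∈ U, η.onConstFields y.2 y.1 = τ fun m => frameCoord (c m) y)
    {z : Box ι × (Fin k → ι → ℝ)} (hz : z ∈ U) (j : Fin k) (v : ι → ℝ) :
    η.onConstFields (Function.update z.2 j v) z.1 =
      fderiv ℝ τ (fun m => frameCoord (c m) z) fun m => frameDir 0 (Pi.single j v) (c m) := by
  obtain ⟨x, b⟩ := z
  let γ : ℝ → Fin k → ι → ℝ := fun s => Function.update b j (b j + s • v)
  have hγ0 : γ 0 = b := by simp [γ]
  have hγc : Continuous γ := by
    refine continuous_const.update j (continuous_const.add (continuous_id.smul continuous_const))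
  have hγ : ∀ s, η.onConstFields (γ s) x =
      η.onConstFields b x + s * η.onConstFields (Function.update b j v) x := by
    intro s
    simp only [← PointForm.onCoords_apply, γ]
    rw [AlternatingMap.map_update_add, AlternatingMap.map_update_smul, Function.update_eq_self,
      smul_eq_mul]
  have hd1 : HasDerivAt (fun s => η.onConstFields (γ s) x)
      (η.onConstFields (Function.update b j v) x) 0 := by
    simp only [hγ]
    simpa using ((hasDerivAt_id' (0 : ℝ)).mul_const
      (η.onConstFields (Function.update b j v) x)).const_add (η.onConstFields b x)
  have hd2 : HasDerivAt (fun s m => frameCoord (c m) (x, γ s))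
      (fun m => frameDir 0 (Pi.single j v) (c m)) 0 := by
    refine hasDerivAt_pi.2 fun m => ?_
    rcases c m with i | ⟨i, g⟩
    · exact hasDerivAt_const (0 : ℝ) (x i : ℝ)
    · by_cases hij : i = j
      · subst hij
        simpa [frameCoord, frameDir, γ] using
          ((hasDerivAt_id' (0 : ℝ)).mul_const (v g)).const_add (b i g)
      · simpa [frameCoord, frameDir, γ, hij] using hasDerivAt_const (0 : ℝ) (b i g)
  have hτ' : HasFDerivAt τ (fderiv ℝ τ fun m => frameCoord (c m) (x, b))
      (fun m => frameCoord (c m) (x, γ 0)) := by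
    rw [hγ0]
    exact (hτ.differentiable (by simp) _).hasFDerivAt
  have hd3 := hτ'.comp_hasDerivAt (0 : ℝ) hd2
  refine hd1.unique (hd3.congr_of_eventuallyEq ?_)
  have hV : (fun s => (x, γ s)) ⁻¹' U ∈ 𝓝 (0 : ℝ) :=
    (continuous_const.prodMk hγc).continuousAt (hU.mem_nhds (by simpa [hγ0] using hz))
  filter_upwards [hV] with s hs
  exact h _ hs

/-- The derivative of `η(X₁, …, X_k)` along a map into `[-1,1]^ι`, for vector fields along the map
with differentiable coordinates. -/
theorem PointForm.exists_hasFDerivAt_onConstFields {ι : Type v} {k : ℕ}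
    {η : PointForm (boxStructure ι) k} (hη : η.IsSmooth) {E : Type w} [NormedAddCommGroup E]
    [NormedSpace ℝ E] {f : E → Box ι} {a : E → Fin k → ι → ℝ} {t : E} {f' : ι → E →L[ℝ] ℝ}
    {a' : Fin k → ι → E →L[ℝ] ℝ} (hfc : ContinuousAt f t)
    (hf : ∀ i, HasFDerivAt (fun s => (f s i : ℝ)) (f' i) t)
    (ha : ∀ j i, HasFDerivAt (fun s => a s j i) (a' j i) t) :
    ∃ L : E →L[ℝ] ℝ, HasFDerivAt (fun s => η.onConstFields (a s) (f s)) L t ∧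
      ∀ v, L v = (boxVector (f t) fun i => f' i v).1
          ⟨η.onConstFields (a t), PointForm.onConstFields_smooth hη _⟩ +
        ∑ j, η.onConstFields (Function.update (a t) j fun i => a' j i v) (f t) := by
  obtain ⟨U, hU, hz, p, c, τ, hτ, h⟩ := frame_local hη.onConstFields_mem (f t, a t)
  let D : Fin p → E →L[ℝ] ℝ := fun m =>
    match c m with
    | .inl i => f' i
    | .inr q => a' q.1 q.2
  have hD : HasFDerivAt (fun s m => frameCoord (c m) (f s, a s)) (ContinuousLinearMap.pi D) t := by
    refine hasFDerivAt_pi.2 fun m => ?_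
    simp only [D]
    rcases c m with i | q
    · exact hf i
    · exact ha q.1 q.2
  have hac : ContinuousAt a t :=
    continuousAt_pi.2 fun j => continuousAt_pi.2 fun i => (ha j i).continuousAt
  refine ⟨_, ((hτ.differentiable (by simp) _).hasFDerivAt.comp t hD).congr_of_eventuallyEq ?_, ?_⟩
  · filter_upwards [(hfc.prodMk hac) (hU.mem_nhds hz)] with s hs
    exact h _ hs
  · intro v
    have h1 := boxVector_onConstFields hη hU hτ h hz fun i => f' i v
    have h2 := fun j => PointForm.onConstFields_update hU hτ h hz j fun i => a' j i v
    simp only at h1 h2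
    rw [h1]
    simp only [h2]
    -- All terms are values of the same linear map `fderiv ℝ τ`, so it is enough to add up the
    -- directions, coordinate by coordinate; a coordinate of the q-th vector receives only the term
    -- of slot q.
    rw [← map_sum, ← map_add, ContinuousLinearMap.comp_apply]
    congr 1
    funext m
    simp only [ContinuousLinearMap.pi_apply, Pi.add_apply, Finset.sum_apply, D]
    rcases c m with i | ⟨q, i⟩
    · simp [frameDir]
    · simp only [frameDir, Pi.zero_apply, zero_add]
      rw [Finset.sum_eq_single q]
      · simp
      · intro j _ hj
        simp [Pi.single_eq_of_ne hj.symm]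
      · simp

/-! ### Derivatives along subsets of normed spaces -/

/-- The extension by zero is only a carrier for the derivative along `D`: uniqueness of that
derivative lets any local smooth extension compute it. -/
theorem fderivWithin_extend_eq {E : Type v} [NormedAddCommGroup E] [NormedSpace ℝ E] {D : Set E}
    {f : D → ℝ} {t : D} (hD : UniqueDiffWithinAt ℝ D (t : E)) {U : Set E} (hU : U ∈ 𝓝 (t : E))
    {F : E → ℝ} (hF : ContDiff ℝ ∞ F) (h : ∀ y : D, (y : E) ∈ U → f y = F y) :
    fderivWithin ℝ (Function.extend Subtype.val f 0) D (t : E) = fderiv ℝ F t := by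
  rw [← fderivWithin_eq_fderiv hD (hF.differentiable (by simp) _)]
  have h1 : ∀ y : D, Function.extend Subtype.val f (0 : E → ℝ) y = f y :=
    Subtype.val_injective.extend_apply f 0
  refine Filter.EventuallyEq.fderivWithin_eq ?_ ?_
  · filter_upwards [self_mem_nhdsWithin, mem_nhdsWithin_of_mem_nhds hU] with y hy hyU
    exact (h1 ⟨y, hy⟩).trans (h ⟨y, hy⟩ hyU)
  · exact (h1 t).trans (h t (mem_of_mem_nhds hU))

/-- Serves twice: with `A` the identity, to pass from the dense domain of a cube to the whole
interval, and with `A` the insertion of a coordinate, to pass to a face. -/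
theorem fderivWithin_extend_comp {E : Type v} [NormedAddCommGroup E] [NormedSpace ℝ E]
    {E' : Type w} [NormedAddCommGroup E'] [NormedSpace ℝ E'] {D : Set E} {D' : Set E'}
    {A : E → E'} (hA : ContDiff ℝ ∞ A) {κ : D → D'} (hκ : ∀ t : D, (κ t : E') = A t) {t : D}
    (hD : UniqueDiffWithinAt ℝ D (t : E)) (hD' : UniqueDiffWithinAt ℝ D' (κ t : E'))
    {f : D' → ℝ} (hf : f ∈ (smoothOn D').carrier) (v : E) :
    fderivWithin ℝ (Function.extend Subtype.val (f ∘ κ) 0) D (t : E) v =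
      fderivWithin ℝ (Function.extend Subtype.val f 0) D' (κ t : E') (fderiv ℝ A t v) := by
  obtain ⟨U, hU, F, hF, hfF⟩ := hf (κ t)
  have hU' : A ⁻¹' U ∈ 𝓝 (t : E) := hA.continuous.continuousAt (by rwa [← hκ])
  rw [fderivWithin_extend_eq hD' hU hF hfF,
    fderivWithin_extend_eq hD hU' (hF.comp hA) fun y hy => ?_,
    fderiv_comp _ (hF.differentiable (by simp) _) (hA.differentiable (by simp) _), hκ]
  · rfl
  · rw [Function.comp_apply, hfF _ (by rwa [hκ]), hκ]
    rfl

theorem continuous_of_mem_smoothOn {E : Type v} [NormedAddCommGroup E] [NormedSpace ℝ E]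
    {D : Set E} {f : D → ℝ} (hf : f ∈ (smoothOn D).carrier) : Continuous f := by
  rw [continuous_iff_continuousAt]
  intro x
  obtain ⟨U, hU, F, hF, hfF⟩ := hf x
  refine (hF.continuous.comp continuous_subtype_val).continuousAt.congr ?_
  filter_upwards [continuous_subtype_val.continuousAt hU] with y hy
  exact (hfF y hy).symm

theorem contDiffOn_extend {E : Type v} [NormedAddCommGroup E] [NormedSpace ℝ E]
    {D : Set E} {f : D → ℝ} (hf : f ∈ (smoothOn D).carrier) :
    ContDiffOn ℝ ∞ (Function.extend Subtype.val f 0) D := by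
  intro t ht
  obtain ⟨U, hU, F, hF, hfF⟩ := hf ⟨t, ht⟩
  have h1 : ∀ y : D, Function.extend Subtype.val f (0 : E → ℝ) y = f y :=
    Subtype.val_injective.extend_apply f 0
  refine hF.contDiffAt.contDiffWithinAt.congr_of_eventuallyEq ?_ ?_
  · filter_upwards [self_mem_nhdsWithin, mem_nhdsWithin_of_mem_nhds hU] with y hy hyU
    exact (h1 ⟨y, hy⟩).trans (hfF ⟨y, hy⟩ hyU)
  · exact (h1 ⟨t, ht⟩).trans (hfF ⟨t, ht⟩ (mem_of_mem_nhds hU))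

theorem fderivWithin_extend_mem {E : Type v} [NormedAddCommGroup E] [NormedSpace ℝ E]
    {D : Set E} (hD : UniqueDiffOn ℝ D) {f : D → ℝ} (hf : f ∈ (smoothOn D).carrier) (v : E) :
    (fun t : D => fderivWithin ℝ (Function.extend Subtype.val f 0) D (t : E) v) ∈
      (smoothOn D).carrier := by
  intro t
  obtain ⟨U, hU, F, hF, hfF⟩ := hf t
  -- One local extension `F` must compute the derivative at all nearby points, so `U` has to be a
  -- neighbourhood of each of them.
  refine ⟨interior U, interior_mem_nhds.2 hU, fun s => fderiv ℝ F s v,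
    (hF.fderiv_right (m := ∞) (by simp)).clm_apply contDiff_const, fun y hy => ?_⟩
  beta_reduce
  rw [fderivWithin_extend_eq (hD y y.2) (mem_interior_iff_mem_nhds.1 hy) hF hfF]

/-! ### Forms along maps -/

/-- Derivations at different points act on the same algebra. Comparing them there, and then using
`PointForm.congr`, avoids transport between tangent spaces at base points that are equal only
propositionally. -/
theorem TangentPower.ext {M : Type u} {C : DiffStructure M} {k : ℕ} {p q : C.TangentPower k}
    (h1 : p.1 = q.1) (h2 : ∀ j f, (p.2 j).1 f = (q.2 j).1 f) : p = q := by
  obtain ⟨x, a⟩ := p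
  obtain ⟨y, b⟩ := q
  obtain rfl : x = y := h1
  have : a = b := funext fun j => Subtype.ext (LinearMap.ext (h2 j))
  rw [this]

theorem PointForm.congr {M : Type u} {C : DiffStructure M} {k : ℕ} (η : PointForm C k)
    {p q : C.TangentPower k} (h : p = q) : η p.1 p.2 = η q.1 q.2 := by
  rw [h]

theorem PointForm.IsSmooth.pullback {M : Type u} {N : Type v} {C : DiffStructure M}
    {D : DiffStructure N} {F : M → N} {k : ℕ} {η : PointForm D k} (hη : η.IsSmooth)
    (hF : SmoothMap C D F) : (η.pullback hF).IsSmooth := by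
  have h : SmoothMap (C.tangentPowerStructure k) (D.tangentPowerStructure k)
      fun p => ⟨F p.1, fun j => hF.tangentMap p.1 (p.2 j)⟩ := by
    refine smoothMap_generate ?_
    rintro _ (⟨α, hα, rfl⟩ | ⟨α, i, rfl⟩)
    · exact subset_generate _ (Or.inl ⟨_, hF α hα, rfl⟩)
    · exact subset_generate _ (Or.inr ⟨hF.comap α, i, rfl⟩)
  exact h _ hη

/-- A smooth form, evaluated on constant vector fields, along a smooth map. -/
theorem PointForm.IsSmooth.along_mem {E : Type v} [NormedAddCommGroup E] [NormedSpace ℝ E]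
    {D : Set E} (hD : UniqueDiffOn ℝ D) {M : Type u} {C : DiffStructure M} {k : ℕ}
    {η : PointForm C k} (hη : η.IsSmooth) {ρ : D → M} (hρ : SmoothMap (smoothOn D) C ρ)
    (v : Fin k → E) :
    (fun t : D => η (ρ t) fun j => hρ.tangentMap t (tangentVector t (hD t t.2) (v j))) ∈
      (smoothOn D).carrier := by
  have h : SmoothMap (smoothOn D) (C.tangentPowerStructure k)
      fun t => ⟨ρ t, fun j => hρ.tangentMap t (tangentVector t (hD t t.2) (v j))⟩ := by
    refine smoothMap_generate ?_
    rintro _ (⟨α, hα, rfl⟩ | ⟨α, i, rfl⟩)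
    · exact hρ α hα
    · exact fderivWithin_extend_mem hD (hρ α.1 α.2) (v i)
  exact h _ hη

theorem boxCoord_comp_mem {M : Type u} {C : DiffStructure M} {ι : Type v} {ρ : M → Box ι}
    (hρ : SmoothMap C (boxStructure ι) ρ) (i : ι) : (fun x => (ρ x i : ℝ)) ∈ C.carrier :=
  hρ (fun x => (x i : ℝ)) (subset_generate _ ⟨i, rfl⟩)

theorem continuous_of_smoothOn_box {E : Type v} [NormedAddCommGroup E] [NormedSpace ℝ E]
    {D : Set E} {ι : Type w} {ρ : D → Box ι} (hρ : SmoothMap (smoothOn D) (boxStructure ι) ρ) :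
    Continuous ρ :=
  continuous_pi fun i =>
    Continuous.subtype_mk (continuous_of_mem_smoothOn (boxCoord_comp_mem hρ i)) fun t => (ρ t i).2

/-- The tangent map of a map into `[-1,1]^ι` in coordinates. -/
theorem tangentMap_tangentVector_box {E : Type v} [NormedAddCommGroup E] [NormedSpace ℝ E]
    {D : Set E} {ι : Type w} {ρ : D → Box ι} (hρ : SmoothMap (smoothOn D) (boxStructure ι) ρ)
    (t : D) (hD : UniqueDiffWithinAt ℝ D (t : E)) (v : E) :
    hρ.tangentMap t (tangentVector t hD v) = boxVector (ρ t) fun i =>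
      fderivWithin ℝ (Function.extend Subtype.val (fun s => (ρ s i : ℝ)) 0) D (t : E) v := by
  refine Subtype.ext (LinearMap.ext fun α => ?_)
  obtain ⟨U, hU, p, l, σ, hσ, hασ⟩ := box_local α.2 (ρ t)
  rw [boxVector_apply hU hσ hασ]
  change fderivWithin ℝ (Function.extend Subtype.val (α.1 ∘ ρ) 0) D (t : E) v = _
  have hc := continuous_of_smoothOn_box hρ
  choose V hV F hF hFρ using fun m => boxCoord_comp_mem hρ (l m) t
  obtain ⟨W, hW, hWU⟩ := mem_nhds_subtype D t _ |>.1 (hc.continuousAt hU)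
  have hFp : ContDiff ℝ ∞ fun s m => F m s := contDiff_pi.2 hF
  -- Near `t`, `α ∘ ρ` is `σ` composed with local smooth extensions `F m` of the finitely many
  -- coordinates involved; `W` keeps `ρ` inside the set where `σ` represents `α`.
  rw [fderivWithin_extend_eq hD (Filter.inter_mem hW (Filter.iInter_mem.2 hV)) (hσ.comp hFp)
    fun y hy => ?_]
  · rw [fderiv_comp _ (hσ.differentiable (by simp) _) (hFp.differentiable (by simp) _)]
    simp only [ContinuousLinearMap.comp_apply]
    have h1 : (fun m => F m (t : E)) = fun m => (ρ t (l m) : ℝ) :=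
      funext fun m => (hFρ m t (mem_of_mem_nhds (hV m))).symm
    rw [h1]
    congr 1
    funext m
    rw [fderivWithin_extend_eq hD (hV m) (hF m) (hFρ m),
      fderiv_pi fun m => (hF m).differentiable (by simp) _]
    rfl
  · rw [Function.comp_apply, hασ _ (hWU hy.1)]
    simp only [Function.comp_apply]
    congr 1
    exact funext fun m => hFρ m y (mem_iInter.1 hy.2 m)

/-! ### The completion and the box -/

/-- The bound is a closed condition and holds on the dense image of `M`. -/
theorem extendToCompl_mem_Icc {M : Type u} {G : Set (M → ℝ)} (hb : ∀ g ∈ G, ∀ x, |g x| ≤ 1)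
    {g : M → ℝ} (hg : g ∈ G) (z : Compl G) : extendToCompl G g z ∈ Icc (-1 : ℝ) 1 := by
  refine UniformSpace.Completion.induction_on z ?_ fun x => ?_
  · exact isClosed_Icc.preimage UniformSpace.Completion.continuous_extension
  · change extendToCompl G g (toCompl G x) ∈ _
    rw [extendToCompl_toCompl hg x]
    exact abs_le.1 (hb g hg x)

/-- The extension of `toBox` to the completion. -/
noncomputable def complToBox {M : Type u} {G : Set (M → ℝ)} (hb : ∀ g ∈ G, ∀ x, |g x| ≤ 1)
    (z : Compl G) : Box G :=
  fun g => ⟨extendToCompl G g.1 z, extendToCompl_mem_Icc hb g.2 z⟩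

theorem smoothMap_complToBox {M : Type u} {G : Set (M → ℝ)} (hb : ∀ g ∈ G, ∀ x, |g x| ≤ 1) :
    SmoothMap (complStructure G) (boxStructure G) (complToBox hb) := by
  refine smoothMap_generate ?_
  rintro _ ⟨g, rfl⟩
  exact subset_generate _ ⟨g.1, g.2, rfl⟩

theorem complToBox_toCompl {M : Type u} {G : Set (M → ℝ)} (hb : ∀ g ∈ G, ∀ x, |g x| ≤ 1) (x : M) :
    complToBox hb (toCompl G x) = toBox hb x :=
  funext fun g => Subtype.ext (extendToCompl_toCompl g.2 x)

theorem SmoothMap.comp {M₁ : Type*} {M₂ : Type*} {M₃ : Type*} {C₁ : DiffStructure M₁}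
    {C₂ : DiffStructure M₂} {C₃ : DiffStructure M₃} {F : M₂ → M₃} {H : M₁ → M₂}
    (hF : SmoothMap C₂ C₃ F) (hH : SmoothMap C₁ C₂ H) : SmoothMap C₁ C₃ (F ∘ H) :=
  fun f hf => hH _ (hF f hf)

/-- The pullbacks of two smooth forms along a map of the unit interval agree if they agree on a
dense subset. -/
theorem PointForm.along_eq_of_pullback_eq {M N : Type*} {C : DiffStructure M}
    {C' : DiffStructure N} {n k : ℕ} (φ : GenCube C n) {ι : M → N} (hι : SmoothMap C C' ι)
    {ρ : unitCube n → N} (hρ : SmoothMap (smoothOn (unitCube n)) C' ρ)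
    (hρφ : ∀ t : φ.dom, ρ ⟨t, φ.dom_subset t.2⟩ = ι (φ.toFun t)) {η η' : PointForm C' k}
    (hη : η.IsSmooth) (hη' : η'.IsSmooth) (h : η.pullback hι = η'.pullback hι)
    (v : Fin k → Fin n → ℝ) (t : unitCube n) :
    η (ρ t) (fun j => hρ.tangentMap t (tangentVector t (uniqueDiffOn_unitCube n t t.2) (v j))) =
      η' (ρ t)
        fun j => hρ.tangentMap t (tangentVector t (uniqueDiffOn_unitCube n t t.2) (v j)) := by
  let incl : φ.dom → unitCube n := fun t => ⟨t, φ.dom_subset t.2⟩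
  have hd : DenseRange incl := by
    intro s
    have h1 := φ.dense s.2
    rw [closure_subtype]
    convert h1
    ext y
    constructor
    · rintro ⟨_, ⟨r, rfl⟩, rfl⟩
      exact r.2
    · exact fun hy => ⟨incl ⟨y, hy⟩, ⟨_, rfl⟩, rfl⟩
  have hc := continuous_of_mem_smoothOn (hη.along_mem (uniqueDiffOn_unitCube n) hρ v)
  have hc' := continuous_of_mem_smoothOn (hη'.along_mem (uniqueDiffOn_unitCube n) hρ v)
  refine congrFun (hd.equalizer hc hc' (funext fun s => ?_)) t
  -- Over the domain of the cube, the tangent vectors of `ρ` come from `M`: the derivative within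
  -- the interval agrees with that within its dense subset, by the chain rule along the inclusion.
  have key : (⟨ρ (incl s), fun j => hρ.tangentMap (incl s) (tangentVector (incl s)
      (uniqueDiffOn_unitCube n (incl s) (incl s).2) (v j))⟩ : C'.TangentPower k) =
      ⟨ι (φ.toFun s), fun j => hι.tangentMap _ (φ.smooth.tangentMap s
        (tangentVector s (φ.uniqueDiffWithinAt s) (v j)))⟩ := by
    refine TangentPower.ext (hρφ s) fun j α => ?_
    change fderivWithin ℝ (Function.extend Subtype.val (α.1 ∘ ρ) 0) (unitCube n) (incl s : Fin n → ℝ)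
      (v j) = fderivWithin ℝ (Function.extend Subtype.val (α.1 ∘ ι ∘ φ.toFun) 0) φ.dom
        (s : Fin n → ℝ) (v j)
    have h2 : α.1 ∘ ι ∘ φ.toFun = (α.1 ∘ ρ) ∘ incl :=
      funext fun r => congrArg α.1 (hρφ r).symm
    rw [h2, fderivWithin_extend_comp contDiff_id (κ := incl) (fun _ => rfl)
      (φ.uniqueDiffWithinAt s) (uniqueDiffOn_unitCube n (incl s) (incl s).2) (hρ α.1 α.2)]
    simp
  have h3 := congrFun h (φ.toFun s)
  have h4 := DFunLike.congr_fun h3 fun j => φ.smooth.tangentMap s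
    (tangentVector s (φ.uniqueDiffWithinAt s) (v j))
  exact (η.congr key).trans (h4.trans (η'.congr key).symm)

/-! ### Integrals over cubes -/

/-- The definition picks some continuous extension; any two agree on the closure of the domain,
hence on the cube, so every extension computes the integral. -/
theorem GenCube.integral_eq {M : Type u} {C : DiffStructure M} {n : ℕ} (φ : GenCube C n)
    (η : PointForm C n) {w : (Fin n → ℝ) → ℝ} (hw : IsContinuousExtension (φ.density η rfl) w) :
    φ.integral η = ∫ t in unitCube n, w t := by
  have hex : ∃ w, IsContinuousExtension (φ.density η rfl) w := ⟨w, hw⟩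
  rw [GenCube.integral, dif_pos rfl, dif_pos hex]
  refine MeasureTheory.setIntegral_congr_fun measurableSet_Icc ?_
  have h := hex.choose_spec
  have heq : EqOn hex.choose w φ.dom := fun t ht => (h.2 ⟨t, ht⟩).trans (hw.2 ⟨t, ht⟩).symm
  exact heq.of_subset_closure h.1 hw.1 φ.dom_subset φ.dense

theorem GenCube.integralExists_of_isContinuousExtension {M : Type u} {C : DiffStructure M} {n : ℕ}
    (φ : GenCube C n) (η : PointForm C n) {w : (Fin n → ℝ) → ℝ}
    (hw : IsContinuousExtension (φ.density η rfl) w) : φ.IntegralExists η :=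
  fun _ => ⟨w, hw⟩

/-! ### Stokes' theorem for smooth maps of a cube into a box -/

/-- The coordinates of the tangent vectors `∂f/∂tʲ`, for a map `f : [0,1]^n → [-1,1]^ι`. -/
noncomputable def cubeFrame {n : ℕ} {ι : Type v} (f : unitCube n → Box ι) (t : Fin n → ℝ)
    (j : Fin n) (i : ι) : ℝ :=
  fderivWithin ℝ (Function.extend Subtype.val (fun s => (f s i : ℝ)) 0) (unitCube n) t
    (Pi.single j 1)

/-- An extension of a map from `[0,1]^n` to `ℝⁿ`. -/
noncomputable def cubeLift {n : ℕ} {X : Type v} (f : unitCube n → X) (t : Fin n → ℝ) : X :=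
  Function.extend Subtype.val f (fun _ => f ⟨0, le_rfl, zero_le_one⟩) t

theorem cubeLift_coe {n : ℕ} {X : Type v} (f : unitCube n → X) (t : unitCube n) :
    cubeLift f t = f t :=
  Subtype.val_injective.extend_apply f _ t

theorem continuousOn_cubeLift {n : ℕ} {X : Type v} [TopologicalSpace X] {f : unitCube n → X}
    (hf : Continuous f) : ContinuousOn (cubeLift f) (unitCube n) := by
  rw [continuousOn_iff_continuous_domRestrict]
  exact hf.congr fun t => (cubeLift_coe f t).symm

theorem continuousOn_cubeFrame {n : ℕ} {ι : Type v} {f : unitCube n → Box ι}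
    (hf : SmoothMap (smoothOn (unitCube n)) (boxStructure ι) f) :
    ContinuousOn (cubeFrame f) (unitCube n) :=
  continuousOn_pi.2 fun j => continuousOn_pi.2 fun i =>
    ((contDiffOn_extend (boxCoord_comp_mem hf i)).continuousOn_fderivWithin
      (uniqueDiffOn_unitCube n) (by simp)).clm_apply continuousOn_const

/-! ### The exterior derivative on constant fields -/

theorem PointForm.continuous_onConstFields {ι : Type v} {k : ℕ} {η : PointForm (boxStructure ι) k}
    (hη : η.IsSmooth) :
    Continuous fun z : Box ι × (Fin k → ι → ℝ) => η.onConstFields z.2 z.1 :=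
  continuous_of_mem_frameStructure hη.onConstFields_mem

theorem boxCoord_boxVector {ι : Type v} (x : Box ι) (a : ι → ℝ) : boxCoord (boxVector x a) = a := by
  funext i
  have h := boxVector_apply (f := ⟨fun x => (x i : ℝ), subset_generate _ ⟨i, rfl⟩⟩) (x := x)
    Filter.univ_mem (contDiff_apply ℝ ℝ (0 : Fin 1)) (l := fun _ => i) (fun _ _ => rfl) a
  refine h.trans ?_
  have := (hasFDerivAt_apply (𝕜 := ℝ) (0 : Fin 1) fun _ : Fin 1 => (x i : ℝ)).fderiv
  erw [this]
  rfl

theorem PointForm.extDeriv_onConstFields {ι : Type v} {k : ℕ} {η : PointForm (boxStructure ι) k}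
    (hη : η.IsSmooth) (a : Fin (k + 1) → ι → ℝ) (x : Box ι) :
    (η.extDeriv hη).onConstFields a x = ∑ j : Fin (k + 1), (-1 : ℝ) ^ (j : ℕ) *
      (boxVector x (a j)).1
        ⟨η.onConstFields (j.removeNth a), PointForm.onConstFields_smooth hη _⟩ := by
  rw [PointForm.onConstFields, PointForm.extDeriv, AlternatingMap.alternatizeUncurryFin_apply]
  refine Finset.sum_congr rfl fun j _ => ?_
  have h : (fun i => boxCoord (j.removeNth (fun j => boxVector x (a j)) i)) = j.removeNth a :=
    funext fun i => boxCoord_boxVector x _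
  change (-1 : ℤ) ^ (j : ℕ) • (boxVector x (a j)).1 ⟨η.onConstFields (fun i =>
    boxCoord (j.removeNth (fun j => boxVector x (a j)) i)), _⟩ = _
  simp only [h]
  rw [zsmul_eq_mul]
  simp

theorem PointForm.continuous_extDeriv_onConstFields {ι : Type v} {k : ℕ}
    {η : PointForm (boxStructure ι) k} (hη : η.IsSmooth) :
    Continuous fun z : Box ι × (Fin (k + 1) → ι → ℝ) =>
      (η.extDeriv hη).onConstFields z.2 z.1 := by
  simp only [PointForm.extDeriv_onConstFields]
  refine continuous_finsetSum _ fun j _ => continuous_const.mul ?_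
  have h : Continuous fun z : Box ι × (Fin (k + 1) → ι → ℝ) =>
      (((z.1, j.removeNth z.2), z.2 j) : (Box ι × (Fin k → ι → ℝ)) × (ι → ℝ)) := by
    refine (continuous_fst.prodMk (continuous_pi fun i => ?_)).prodMk ?_
    · exact (continuous_apply _).comp continuous_snd
    · exact (continuous_apply _).comp continuous_snd
  exact (continuous_boxVector_onConstFields hη).comp h

/-! ### Differentiation at interior points and the divergence theorem -/

theorem unitCube_mem_nhds {n : ℕ} {t : Fin n → ℝ}
    (ht : t ∈ pi univ fun i : Fin n => Ioo ((0 : Fin n → ℝ) i) ((1 : Fin n → ℝ) i)) :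
    unitCube n ∈ 𝓝 t := by
  refine Filter.mem_of_superset
    ((isOpen_set_pi finite_univ fun _ _ => isOpen_Ioo).mem_nhds ht) ?_
  rw [unitCube, ← pi_univ_Icc]
  exact pi_mono fun i _ => Ioo_subset_Icc_self

/-- At an interior point the derivative within the cube is an ordinary one throughout a
neighbourhood, so the tangent vectors can be differentiated again; the last clause is the symmetry
of second derivatives. -/
theorem cubeFrame_hasFDerivAt {n : ℕ} {ι : Type v} {f : unitCube n → Box ι}
    (hf : SmoothMap (smoothOn (unitCube n)) (boxStructure ι) f) {t : Fin n → ℝ}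
    (ht : unitCube n ∈ 𝓝 t) :
    ∃ (f' : ι → (Fin n → ℝ) →L[ℝ] ℝ) (a' : Fin n → ι → (Fin n → ℝ) →L[ℝ] ℝ),
      (∀ i, HasFDerivAt (fun s => (cubeLift f s i : ℝ)) (f' i) t) ∧
      (∀ j i, HasFDerivAt (fun s => cubeFrame f s j i) (a' j i) t) ∧
      (∀ j i, f' i (Pi.single j 1) = cubeFrame f t j i) ∧
      ∀ j l i, a' j i (Pi.single l 1) = a' l i (Pi.single j 1) := by
  let F : ι → (Fin n → ℝ) → ℝ := fun i => Function.extend Subtype.val (fun s => (f s i : ℝ)) 0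
  have hF : ∀ i, ContDiffAt ℝ ∞ (F i) t := fun i =>
    (contDiffOn_extend (boxCoord_comp_mem hf i)).contDiffAt ht
  have hev : ∀ᶠ s in 𝓝 t, unitCube n ∈ 𝓝 s := eventually_mem_nhds_iff.2 ht
  have hF' : ∀ i, DifferentiableAt ℝ (fderiv ℝ (F i)) t := fun i =>
    ((hF i).fderiv_right (m := ∞) (by simp)).differentiableAt (by simp)
  have hev' : ∀ j i, (fun s => cubeFrame f s j i) =ᶠ[𝓝 t] fun s => fderiv ℝ (F i) s (Pi.single j 1) := by
    intro j i
    filter_upwards [hev] with s hs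
    rw [cubeFrame, fderivWithin_of_mem_nhds hs]
  refine ⟨fun i => fderiv ℝ (F i) t,
    fun j i => (fderiv ℝ (fderiv ℝ (F i)) t).flip (Pi.single j 1), ?_, ?_, ?_, ?_⟩
  · intro i
    refine ((hF i).differentiableAt (by simp)).hasFDerivAt.congr_of_eventuallyEq ?_
    filter_upwards [ht] with s hs
    have h1 := cubeLift_coe f ⟨s, hs⟩
    have h2 : F i s = f ⟨s, hs⟩ i :=
      Subtype.val_injective.extend_apply (fun s => (f s i : ℝ)) 0 ⟨s, hs⟩
    rw [h2, ← h1]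
  · intro j i
    refine HasFDerivAt.congr_of_eventuallyEq ?_ (hev' j i)
    have h := (hF' i).hasFDerivAt.clm_apply (hasFDerivAt_const (Pi.single j 1 : Fin n → ℝ) t)
    simpa using h
  · exact fun j i => (hev' j i).self_of_nhds.symm
  · intro j l i
    have hs : IsSymmSndFDerivAt ℝ (F i) t := (hF i).isSymmSndFDerivAt (by
      rw [minSmoothness_of_isRCLikeNormedField]
      exact WithTop.coe_le_coe.2 (le_top : (2 : ℕ∞) ≤ ⊤))
    exact hs.eq _ _

/-- The divergence of the field with components `(-1)ʲ η(∂₁f, …, ∂̂ⱼf, …)` is `dη(∂₁f, …)`. -/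
theorem exists_hasFDerivAt_face {n : ℕ} {ι : Type v} {f : unitCube (n + 1) → Box ι}
    (hf : SmoothMap (smoothOn (unitCube (n + 1))) (boxStructure ι) f)
    {η : PointForm (boxStructure ι) n} (hη : η.IsSmooth) {t : Fin (n + 1) → ℝ}
    (ht : unitCube (n + 1) ∈ 𝓝 t) :
    ∃ L : Fin (n + 1) → (Fin (n + 1) → ℝ) →L[ℝ] ℝ,
      (∀ j : Fin (n + 1), HasFDerivAt (fun s => (-1 : ℝ) ^ (j : ℕ) *
        η.onConstFields (j.removeNth (cubeFrame f s)) (cubeLift f s)) (L j) t) ∧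
      ∑ j, L j (Pi.single j 1) = (η.extDeriv hη).onConstFields (cubeFrame f t) (cubeLift f t) := by
  obtain ⟨f', a', hf', ha', hfa, hsymm⟩ := cubeFrame_hasFDerivAt hf ht
  have hc : ContinuousAt (cubeLift f) t :=
    (continuousOn_cubeLift (continuous_of_smoothOn_box hf)).continuousAt ht
  have h1 := fun j : Fin (n + 1) => PointForm.exists_hasFDerivAt_onConstFields hη
    (a := fun s => j.removeNth (cubeFrame f s)) hc hf' (fun l i => ha' (j.succAbove l) i)
  choose L hL hLv using h1
  refine ⟨fun j => (-1 : ℝ) ^ (j : ℕ) • L j, fun j => (hL j).const_mul _, ?_⟩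
  -- The replaced vector is ∂ⱼ∂ₗf. The vanishing sum is then added to dη, so that the two sides can
  -- be compared term by term in `j`.
  have h2 := sum_neg_one_pow_update_removeNth_eq_zero (η.onCoords (cubeLift f t)) (cubeFrame f t)
    (fun j l i => a' l i (Pi.single j 1)) (fun j l => funext fun i => hsymm l j i)
  rw [PointForm.extDeriv_onConstFields]
  refine Eq.trans ?_ ((congrArg (_ + ·) h2).trans (add_zero _))
  rw [← Finset.sum_add_distrib]
  refine Finset.sum_congr rfl fun j _ => ?_
  rw [smul_apply, hLv, smul_eq_mul, mul_add]
  simp only [hfa]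
  rfl

theorem continuousOn_extDeriv_cubeFrame {n : ℕ} {ι : Type v} {f : unitCube (n + 1) → Box ι}
    (hf : SmoothMap (smoothOn (unitCube (n + 1))) (boxStructure ι) f)
    {η : PointForm (boxStructure ι) n} (hη : η.IsSmooth) :
    ContinuousOn (fun t => (η.extDeriv hη).onConstFields (cubeFrame f t) (cubeLift f t))
      (unitCube (n + 1)) := by
  have h : ContinuousOn (fun t => (cubeLift f t, cubeFrame f t)) (unitCube (n + 1)) :=
    (continuousOn_cubeLift (continuous_of_smoothOn_box hf)).prodMk (continuousOn_cubeFrame hf)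
  have h' := PointForm.continuous_extDeriv_onConstFields hη
  exact (h'.comp_continuousOn h).congr fun t _ => rfl

theorem continuousOn_removeNth_cubeFrame {n : ℕ} {ι : Type v} {f : unitCube (n + 1) → Box ι}
    (hf : SmoothMap (smoothOn (unitCube (n + 1))) (boxStructure ι) f)
    {η : PointForm (boxStructure ι) n} (hη : η.IsSmooth) (j : Fin (n + 1)) :
    ContinuousOn (fun t => η.onConstFields (j.removeNth (cubeFrame f t)) (cubeLift f t))
      (unitCube (n + 1)) := by
  have h : ContinuousOn (fun t => (cubeLift f t, j.removeNth (cubeFrame f t)))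
      (unitCube (n + 1)) :=
    (continuousOn_cubeLift (continuous_of_smoothOn_box hf)).prodMk
      (continuousOn_pi.2 fun l => continuousOn_pi.1 (continuousOn_cubeFrame hf) (j.succAbove l))
  have h' := PointForm.continuous_onConstFields hη
  exact (h'.comp_continuousOn h).congr fun t _ => rfl

theorem integral_extDeriv_cubeFrame {n : ℕ} {ι : Type v} {f : unitCube (n + 1) → Box ι}
    (hf : SmoothMap (smoothOn (unitCube (n + 1))) (boxStructure ι) f)
    {η : PointForm (boxStructure ι) n} (hη : η.IsSmooth) :
    ∫ t in unitCube (n + 1), (η.extDeriv hη).onConstFields (cubeFrame f t) (cubeLift f t) =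
      ∑ i : Fin (n + 1), ∑ a : Fin 2, (-1 : ℝ) ^ ((i : ℕ) + 1 + (a : ℕ)) *
        ∫ t in unitCube n,
          η.onConstFields (i.removeNth (cubeFrame f (i.insertNth (α := fun _ => ℝ) (a : ℕ) t)))
            (cubeLift f (i.insertNth (α := fun _ => ℝ) (a : ℕ) t)) := by
  classical
  let P : Set (Fin (n + 1) → ℝ) :=
    pi univ fun i : Fin (n + 1) => Ioo ((0 : Fin (n + 1) → ℝ) i) ((1 : Fin (n + 1) → ℝ) i)
  have hP : P =ᵐ[MeasureTheory.volume] unitCube (n + 1) := MeasureTheory.Measure.univ_pi_Ioo_ae_eq_Icc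
  have hPm : MeasurableSet P := MeasurableSet.univ_pi fun i => measurableSet_Ioo
  -- Derivatives are available only in the open cube; the value 0 elsewhere is harmless, the
  -- boundary being a null set.
  have hL : ∀ t, ∃ L : Fin (n + 1) → (Fin (n + 1) → ℝ) →L[ℝ] ℝ, t ∈ P →
      (∀ j : Fin (n + 1), HasFDerivAt (fun s => (-1 : ℝ) ^ (j : ℕ) *
        η.onConstFields (j.removeNth (cubeFrame f s)) (cubeLift f s)) (L j) t) ∧
      ∑ j, L j (Pi.single j 1) = (η.extDeriv hη).onConstFields (cubeFrame f t) (cubeLift f t) := by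
    intro t
    by_cases ht : t ∈ P
    · obtain ⟨L, hL⟩ := exists_hasFDerivAt_face hf hη (unitCube_mem_nhds ht)
      exact ⟨L, fun _ => hL⟩
    · exact ⟨0, fun h => absurd h ht⟩
  choose L hL using hL
  have hint := (continuousOn_extDeriv_cubeFrame hf hη).integrableOn_compact
    (μ := MeasureTheory.volume) isCompact_Icc
  have hdiv := MeasureTheory.integral_divergence_of_hasFDerivAt_off_countable' (0 : Fin (n + 1) → ℝ) 1
    zero_le_one (fun (j : Fin (n + 1)) s => (-1 : ℝ) ^ (j : ℕ) *
        η.onConstFields (j.removeNth (cubeFrame f s)) (cubeLift f s)) (fun j t => L t j) ∅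
    countable_empty (fun j => continuousOn_const.mul (continuousOn_removeNth_cubeFrame hf hη j))
    (fun t ht j => (hL t ht.1).1 j) ?_
  · have h1 : ∫ t in unitCube (n + 1), ∑ j, L t j (Pi.single j 1) =
        ∫ t in unitCube (n + 1),
          (η.extDeriv hη).onConstFields (cubeFrame f t) (cubeLift f t) := by
      rw [← MeasureTheory.setIntegral_congr_set hP, ← MeasureTheory.setIntegral_congr_set hP]
      exact MeasureTheory.setIntegral_congr_fun hPm fun t ht => (hL t ht).2
    rw [← h1]
    refine hdiv.trans (Finset.sum_congr rfl fun i _ => ?_)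
    rw [Fin.sum_univ_two, MeasureTheory.integral_const_mul, MeasureTheory.integral_const_mul]
    -- The divergence theorem gives the face `a = 1` minus the face `a = 0`, each with the factor
    -- (-1)ⁱ of the component. This is (-1)^(i+1+a), since `i` counts from 0.
    simp only [Fin.val_zero, Fin.val_one, Nat.cast_zero, Nat.cast_one, Pi.zero_apply, Pi.one_apply,
      add_zero, pow_succ]
    have h0 : Icc ((0 : Fin (n + 1) → ℝ) ∘ i.succAbove) ((1 : Fin (n + 1) → ℝ) ∘ i.succAbove) = unitCube n := rfl
    rw [h0]
    ring
  · refine MeasureTheory.IntegrableOn.congr_set_ae ?_ hP.symm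
    refine (MeasureTheory.integrableOn_congr_fun (fun t ht => (hL t ht).2) hPm).2 ?_
    exact hint.congr_set_ae hP

/-! ### Stokes' theorem for smoothly extendable cubes -/

theorem GenCube.extension_apply {M : Type u} {C : DiffStructure M} {n : ℕ} {G : Set (M → ℝ)}
    (φ : GenCube C n) (h : φ.IsSmoothlyExtendable G) (t : φ.dom) :
    φ.extension h ⟨t, φ.dom_subset t.2⟩ = toCompl G (φ.toFun t) :=
  h.exists_extension.choose_spec.2.1 t

/-- Functoriality of pullback along the triangle M → compl_G M → [-1,1]^G, which commutes by
`complToBox_toCompl`. -/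
theorem PointForm.pullback_complToBox_toCompl {M : Type u} {C : DiffStructure M} {G : Set (M → ℝ)}
    (hG : C = generate G) (hb : ∀ g ∈ G, ∀ x, |g x| ≤ 1) {k : ℕ}
    (η : PointForm (boxStructure G) k) :
    (η.pullback (smoothMap_complToBox hb)).pullback (smoothMap_toCompl hG) =
      η.pullback (smoothMap_toBox hG hb) := by
  funext m
  refine AlternatingMap.ext fun w => ?_
  refine η.congr (p := ⟨_, fun j => (smoothMap_complToBox hb).tangentMap _
    ((smoothMap_toCompl hG).tangentMap m (w j))⟩) (q := ⟨_, fun j =>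
      (smoothMap_toBox hG hb).tangentMap m (w j)⟩) ?_
  refine TangentPower.ext (complToBox_toCompl hb m) fun j α => ?_
  refine congrArg (w j).1 (Subtype.ext ?_)
  exact funext fun x => congrArg α.1 (complToBox_toCompl hb x)

/-- The extension of a cube, as a map into `[-1,1]^G`. -/
noncomputable def GenCube.boxExtension {M : Type u} {C : DiffStructure M} {n : ℕ}
    {G : Set (M → ℝ)} (φ : GenCube C n) (h : φ.IsSmoothlyExtendable G)
    (hb : ∀ g ∈ G, ∀ x, |g x| ≤ 1) : unitCube n → Box G :=
  complToBox hb ∘ φ.extension h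

theorem GenCube.smoothMap_boxExtension {M : Type u} {C : DiffStructure M} {n : ℕ}
    {G : Set (M → ℝ)} (φ : GenCube C n) (h : φ.IsSmoothlyExtendable G)
    (hb : ∀ g ∈ G, ∀ x, |g x| ≤ 1) :
    SmoothMap (smoothOn (unitCube n)) (boxStructure G) (φ.boxExtension h hb) :=
  (smoothMap_complToBox hb).comp (φ.smoothMap_extension h)

theorem GenCube.boxExtension_apply {M : Type u} {C : DiffStructure M} {n : ℕ}
    {G : Set (M → ℝ)} (φ : GenCube C n) (h : φ.IsSmoothlyExtendable G)
    (hb : ∀ g ∈ G, ∀ x, |g x| ≤ 1) (t : φ.dom) :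
    φ.boxExtension h hb ⟨t, φ.dom_subset t.2⟩ = toBox hb (φ.toFun t) := by
  rw [GenCube.boxExtension, Function.comp_apply, φ.extension_apply h t, complToBox_toCompl]

/-- On the domain of the cube, e ∘ φ is the restriction of the extended map, and derivatives within
the dense domain are those within the cube. The right side makes sense on the whole cube and so
supplies the continuous extension. -/
theorem GenCube.density_pullback_toBox {M : Type u} {C : DiffStructure M} {n : ℕ}
    {G : Set (M → ℝ)} (hG : C = generate G) (hb : ∀ g ∈ G, ∀ x, |g x| ≤ 1) (φ : GenCube C n)
    (h : φ.IsSmoothlyExtendable G) (θ : PointForm (boxStructure G) n) (t : φ.dom) :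
    φ.density (θ.pullback (smoothMap_toBox hG hb)) rfl t =
      θ.onConstFields (cubeFrame (φ.boxExtension h hb) t) (cubeLift (φ.boxExtension h hb) t) := by
  let incl : φ.dom → unitCube n := fun t => ⟨t, φ.dom_subset t.2⟩
  have hf := φ.smoothMap_boxExtension h hb
  have h1 := cubeLift_coe (φ.boxExtension h hb) (incl t)
  change _ = θ.onConstFields _ (cubeLift (φ.boxExtension h hb) (incl t))
  rw [h1]
  refine θ.congr (p := ⟨_, fun j => (smoothMap_toBox hG hb).tangentMap _ (φ.smooth.tangentMap t
    (tangentVector t (φ.uniqueDiffWithinAt t) (Pi.single j 1)))⟩) (q := ⟨_, fun j =>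
      boxVector (φ.boxExtension h hb (incl t)) (cubeFrame (φ.boxExtension h hb) t j)⟩) ?_
  refine TangentPower.ext (φ.boxExtension_apply h hb t).symm fun j α => ?_
  have h2 := tangentMap_tangentVector_box hf (incl t) (uniqueDiffOn_unitCube n _ (incl t).2)
    (Pi.single j 1)
  refine Eq.trans ?_ (congrArg (fun v => v.1 α) h2)
  change fderivWithin ℝ (Function.extend Subtype.val (α.1 ∘ toBox hb ∘ φ.toFun) 0) φ.dom
    (t : Fin n → ℝ) (Pi.single j 1) = fderivWithin ℝ (Function.extend Subtype.val
      (α.1 ∘ φ.boxExtension h hb) 0) (unitCube n) (incl t : Fin n → ℝ) (Pi.single j 1)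
  have h3 : α.1 ∘ toBox hb ∘ φ.toFun = (α.1 ∘ φ.boxExtension h hb) ∘ incl :=
    funext fun r => congrArg α.1 (φ.boxExtension_apply h hb r).symm
  rw [h3, fderivWithin_extend_comp contDiff_id (κ := incl) (fun _ => rfl)
    (φ.uniqueDiffWithinAt t) (uniqueDiffOn_unitCube n (incl t) (incl t).2) (hf α.1 α.2)]
  simp

theorem fderiv_insertNth {n : ℕ} (i : Fin (n + 1)) (a : ℝ) (t : Fin n → ℝ) (j : Fin n) :
    fderiv ℝ (fun x : Fin n → ℝ => i.insertNth (α := fun _ => ℝ) a x) t (Pi.single j 1) =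
      Pi.single (i.succAbove j) 1 := by
  have h : HasFDerivAt (fun x : Fin n → ℝ => i.insertNth (α := fun _ => ℝ) a x)
      (ContinuousLinearMap.pi fun l => i.insertNth (α := fun _ => (Fin n → ℝ) →L[ℝ] ℝ) 0
        (fun l => ContinuousLinearMap.proj l) l) t := by
    refine hasFDerivAt_pi.2 fun l => ?_
    refine Fin.succAboveCases i ?_ (fun l => ?_) l
    · simpa using hasFDerivAt_const a t
    · simpa using hasFDerivAt_apply (𝕜 := ℝ) l t
  rw [h.fderiv]
  funext l
  refine Fin.succAboveCases i ?_ (fun l => ?_) l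
  · simp
  · simp [Pi.single_apply]

theorem GenCube.density_face {M : Type u} {C : DiffStructure M} {n : ℕ}
    {G : Set (M → ℝ)} (hG : C = generate G) (hb : ∀ g ∈ G, ∀ x, |g x| ≤ 1)
    (φ : GenCube C (n + 1)) (h : φ.IsSmoothlyExtendable G) {η : PointForm (boxStructure G) n}
    (hη : η.IsSmooth) {η' : PointForm (complStructure G) n} (hη' : η'.IsSmooth)
    (heq : η'.pullback (smoothMap_toCompl hG) = η.pullback (smoothMap_toBox hG hb))
    (i : Fin (n + 1)) (a : Fin 2) (t : unitCube n) :
    (φ.face h i a).density η' rfl t = η.onConstFields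
      (i.removeNth (cubeFrame (φ.boxExtension h hb) (i.insertNth (α := fun _ => ℝ) (a : ℕ) t)))
      (cubeLift (φ.boxExtension h hb) (i.insertNth (α := fun _ => ℝ) (a : ℕ) t)) := by
  have hρ := φ.smoothMap_extension h
  have hf := φ.smoothMap_boxExtension h hb
  have hu := uniqueDiffOn_unitCube (n + 1)
  let s := faceMap i a t
  have h1 : η'.pullback (smoothMap_toCompl hG) =
      (η.pullback (smoothMap_complToBox hb)).pullback (smoothMap_toCompl hG) :=
    heq.trans (PointForm.pullback_complToBox_toCompl hG hb η).symm
  -- A face may miss the domain of φ altogether, so the two forms are compared along the extension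
  -- of the whole cube and only then restricted.
  have h2 := PointForm.along_eq_of_pullback_eq φ (smoothMap_toCompl hG) hρ
    (φ.extension_apply h) hη' (hη.pullback _) h1
    (fun j => Pi.single (i.succAbove j) (1 : ℝ)) s
  -- The insertion of a coordinate at place `i` sends the j-th unit vector to the one with index
  -- `i.succAbove j`, so the tangent vectors of the face are those of the extended cube with the
  -- i-th left out.
  have h3 : (φ.face h i a).density η' rfl t = η' (φ.extension h s) fun j =>
      hρ.tangentMap s (tangentVector s (hu s s.2) (Pi.single (i.succAbove j) (1 : ℝ))) := by
    refine η'.congr (p := ⟨_, fun j => (φ.face h i a).smooth.tangentMap t (tangentVector t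
      ((φ.face h i a).uniqueDiffWithinAt t) (Pi.single j 1))⟩) (q := ⟨_, fun j =>
        hρ.tangentMap s (tangentVector s (hu s s.2) (Pi.single (i.succAbove j) (1 : ℝ)))⟩) ?_
    refine TangentPower.ext rfl fun j α => ?_
    have h4 := fderivWithin_extend_comp (contDiff_insertNth i ((a : ℕ) : ℝ)) (κ := faceMap i a)
      (fun _ => rfl) (t := t) (uniqueDiffOn_unitCube n t t.2) (hu s s.2) (hρ α.1 α.2)
      (Pi.single j 1)
    rw [fderiv_insertNth] at h4
    exact h4
  have h5 := cubeLift_coe (φ.boxExtension h hb) s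
  change _ = η.onConstFields _ (cubeLift (φ.boxExtension h hb) s)
  rw [h3, h2, h5]
  refine congrArg (η (φ.boxExtension h hb s)) (funext fun j => ?_)
  exact tangentMap_tangentVector_box hf s (hu s s.2) (Pi.single (i.succAbove j) (1 : ℝ))

theorem GenCube.isContinuousExtension_extDeriv {M : Type u} {C : DiffStructure M} {n : ℕ}
    {G : Set (M → ℝ)} (hG : C = generate G) (hb : ∀ g ∈ G, ∀ x, |g x| ≤ 1)
    (φ : GenCube C (n + 1)) (h : φ.IsSmoothlyExtendable G) {η : PointForm (boxStructure G) n}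
    (hη : η.IsSmooth) :
    IsContinuousExtension (φ.density ((η.extDeriv hη).pullback (smoothMap_toBox hG hb)) rfl)
      fun t => (η.extDeriv hη).onConstFields (cubeFrame (φ.boxExtension h hb) t)
        (cubeLift (φ.boxExtension h hb) t) :=
  ⟨continuousOn_extDeriv_cubeFrame (φ.smoothMap_boxExtension h hb) hη,
    fun t => (φ.density_pullback_toBox hG hb h _ t).symm⟩

theorem GenCube.isContinuousExtension_face {M : Type u} {C : DiffStructure M} {n : ℕ}
    {G : Set (M → ℝ)} (hG : C = generate G) (hb : ∀ g ∈ G, ∀ x, |g x| ≤ 1)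
    (φ : GenCube C (n + 1)) (h : φ.IsSmoothlyExtendable G) {η : PointForm (boxStructure G) n}
    (hη : η.IsSmooth) {η' : PointForm (complStructure G) n} (hη' : η'.IsSmooth)
    (heq : η'.pullback (smoothMap_toCompl hG) = η.pullback (smoothMap_toBox hG hb))
    (i : Fin (n + 1)) (a : Fin 2) :
    IsContinuousExtension ((φ.face h i a).density η' rfl) fun t => η.onConstFields
      (i.removeNth (cubeFrame (φ.boxExtension h hb) (i.insertNth (α := fun _ => ℝ) (a : ℕ) t)))
      (cubeLift (φ.boxExtension h hb) (i.insertNth (α := fun _ => ℝ) (a : ℕ) t)) := by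
  refine ⟨?_, fun t => (φ.density_face hG hb h hη hη' heq i a t).symm⟩
  have h1 := continuousOn_removeNth_cubeFrame (φ.smoothMap_boxExtension h hb) hη i
  exact h1.comp (contDiff_insertNth i ((a : ℕ) : ℝ)).continuous.continuousOn
    fun t ht => (faceMap i a ⟨t, ht⟩).2

/-! ### Chains -/

/-- The integral of a form, as a linear function of the chain. -/
noncomputable def integralLinear {M : Type u} {C : DiffStructure M} {k : ℕ} (n : ℕ)
    (η : PointForm C k) : Chain C n →ₗ[ℝ] ℝ :=
  Finsupp.linearCombination ℝ fun φ => φ.integral η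

theorem integralLinear_apply {M : Type u} {C : DiffStructure M} {k n : ℕ}
    (η : PointForm C k) (Φ : Chain C n) : integralLinear n η Φ = Φ.integral η := rfl

theorem integralLinear_boundary {M : Type u} {C : DiffStructure M} {k n : ℕ} {G : Set (M → ℝ)}
    (φ : GenCube C (n + 1)) (h : φ.IsSmoothlyExtendable G) (η : PointForm (complStructure G) k) :
    integralLinear n η (φ.boundary h) = ∑ i : Fin (n + 1), ∑ a : Fin 2,
      (-1 : ℝ) ^ ((i : ℕ) + 1 + (a : ℕ)) * (φ.face h i a).integral η := by
  simp [GenCube.boundary, integralLinear]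

/-- Summing over the attached support supplies the proof of extendability and removes the case
distinction from the definition. -/
theorem Chain.boundary_eq {M : Type u} {C : DiffStructure M} {n : ℕ} {G : Set (M → ℝ)}
    {Φ : Chain C (n + 1)} (hΦ : Φ.IsSmoothlyExtendable G) :
    Φ.boundary G = ∑ φ ∈ Φ.support.attach, Φ φ.1 • φ.1.boundary (hΦ φ.1 φ.2) := by
  classical
  rw [Chain.boundary, Finsupp.sum, ← Finset.sum_attach]
  exact Finset.sum_congr rfl fun φ _ => dif_pos (hΦ φ.1 φ.2)

/-- Faces may coincide or cancel, so the support of the boundary is only contained in the set of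
faces. Chains supported on cubes with existing integral form a submodule, and that suffices. -/
theorem Chain.integralExists_boundary {M : Type u} {C : DiffStructure M} {k n : ℕ}
    {G : Set (M → ℝ)} {Φ : Chain C (n + 1)} (hΦ : Φ.IsSmoothlyExtendable G)
    {η : PointForm (complStructure G) k}
    (hη : ∀ φ (h : φ ∈ Φ.support) (i : Fin (n + 1)) (a : Fin 2),
      (φ.face (hΦ φ h) i a).IntegralExists η) : (Φ.boundary G).IntegralExists η := by
  have h : Φ.boundary G ∈ Finsupp.supported ℝ ℝ
      {ψ : GenCube (complStructure G) n | ψ.IntegralExists η} := by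
    rw [Chain.boundary_eq hΦ]
    refine Submodule.sum_mem _ fun φ _ => Submodule.smul_mem _ _ ?_
    refine Submodule.sum_mem _ fun i _ => Submodule.sum_mem _ fun a _ => ?_
    exact Finsupp.single_mem_supported ℝ _ (hη φ.1 φ.2 i a)
  exact fun φ hφ => h hφ

/-- The integral is linear in the chain, so Stokes' formula for single cubes is enough, whatever
cancellations occur between faces. -/
theorem Chain.integral_boundary {M : Type u} {C : DiffStructure M} {k l n : ℕ} {G : Set (M → ℝ)}
    {Φ : Chain C (n + 1)} (hΦ : Φ.IsSmoothlyExtendable G) {η : PointForm (complStructure G) k}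
    {θ : PointForm C l}
    (h : ∀ φ (h : φ ∈ Φ.support), ∑ i : Fin (n + 1), ∑ a : Fin 2,
      (-1 : ℝ) ^ ((i : ℕ) + 1 + (a : ℕ)) * (φ.face (hΦ φ h) i a).integral η = φ.integral θ) :
    (Φ.boundary G).integral η = Φ.integral θ := by
  rw [← integralLinear_apply, Chain.boundary_eq hΦ, map_sum, Chain.integral, Finsupp.sum,
    ← Finset.sum_attach Φ.support]
  refine Finset.sum_congr rfl fun φ _ => ?_
  rw [map_smul, integralLinear_boundary, h φ.1 φ.2, smul_eq_mul]

end DiffSpace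

/-! ### Stokes' theorem for smoothly extendable chains -/

theorem mainTheorem3 {M : Type*} (C : DiffSpace.DiffStructure M) (G : Set (M → ℝ))
    (hG : C = DiffSpace.generate G) (hb : ∀ g ∈ G, ∀ x, |g x| ≤ 1) (k n : ℕ)
    (η : DiffSpace.PointForm C k) (hη : η.IsSmooth) (hηG : η.IsSmoothlyExtendable hG)
    (Φ : DiffSpace.Chain C (n + 1)) (hΦ : Φ.IsSmoothlyExtendable G)
    (η₁ : DiffSpace.PointForm (DiffSpace.boxStructure G) k) (hη₁ : η₁.IsSmooth)
    (hext : η₁.pullback (DiffSpace.smoothMap_toBox hG hb) = η) :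
    Φ.IntegralExists ((η₁.extDeriv hη₁).pullback (DiffSpace.smoothMap_toBox hG hb)) ∧
    ∀ η' : DiffSpace.PointForm (DiffSpace.complStructure G) k, η'.IsSmooth →
      η'.pullback (DiffSpace.smoothMap_toCompl hG) = η →
      (Φ.boundary G).IntegralExists η' ∧
      (Φ.boundary G).integral η' =
        Φ.integral ((η₁.extDeriv hη₁).pullback (DiffSpace.smoothMap_toBox hG hb)) := by
  by_cases hkn : k = n
  · subst hkn
    refine ⟨fun φ hφ => φ.integralExists_of_isContinuousExtension _
      (φ.isContinuousExtension_extDeriv hG hb (hΦ φ hφ) hη₁), fun η' hη' heq => ?_⟩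
    -- The given `η'` enters only here: on faces its density extends continuously to an expression
    -- in `η₁` alone, the one produced by the divergence theorem.
    have hface := fun φ (hφ : φ ∈ Φ.support) =>
      φ.isContinuousExtension_face hG hb (hΦ φ hφ) hη₁ hη' (heq.trans hext.symm)
    refine ⟨DiffSpace.Chain.integralExists_boundary hΦ fun φ hφ i a =>
      DiffSpace.GenCube.integralExists_of_isContinuousExtension _ _ (hface φ hφ i a),
      DiffSpace.Chain.integral_boundary hΦ fun φ hφ => ?_⟩
    rw [φ.integral_eq _ (φ.isContinuousExtension_extDeriv hG hb (hΦ φ hφ) hη₁),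
      DiffSpace.integral_extDeriv_cubeFrame (φ.smoothMap_boxExtension (hΦ φ hφ) hb) hη₁]
    refine Finset.sum_congr rfl fun i _ => Finset.sum_congr rfl fun a _ => ?_
    rw [DiffSpace.GenCube.integral_eq _ _ (hface φ hφ i a)]
  -- The degrees now fail to match on both sides, so every integral is 0 by convention.
  · have hkn' : k + 1 ≠ n + 1 := fun h => hkn (Nat.succ_injective h)
    refine ⟨fun φ _ h => absurd h hkn', fun η' _ _ => ⟨fun φ _ h => absurd h hkn, ?_⟩⟩
    refine DiffSpace.Chain.integral_boundary hΦ fun φ hφ => ?_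
    simp [DiffSpace.GenCube.integral, hkn]
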